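/- Let $d \geq 1$ be an integer and let $\delta > 0$. There is a constant $K = K(d,\delta)$, depending only on $d$ and $\delta$, such that the following holds. Let $\mathbb{F}$ be a finite field of prime order with $|\mathbb{F}| > d+1$, let $n \geq 0$ be an integer, and let $P : \mathbb{F}^n \to \mathbb{F}$ be a polynomial of degree at most $d+1$. Write $f(x) := e_{\mathbb{F}}(P(x))$ and suppose that $\|f\|_{U^{d+1}} \geq \delta$. Then $\operatorname{rank}_d(P) \leq K$. Here $e_{\mathbb{F}}(j) := e^{2\pi i j/|\mathbb{F}|}$ for $j = 0, \dots, |\mathbb{F}|-1$. A function $P : \mathbb{F}^n \to \mathbb{F}$ is a polynomial of degree at most $k$ if $D_{h_1} \cdots D_{h_{k+1}} P = 0$ for all $h_1, \dots, h_{k+1} \in \mathbb{F}^n$, where $D_h P(x) := P(x+h) - P(x)$. For $f : \mathbb{F}^n \to \mathbb{C}$, $$\|f\|_{U^{d+1}} := \Bigl| \mathbb{E}_{h_1,\dots,h_{d+1},x \in \mathbb{F}^n}\, \Delta_{h_1} \cdots \Delta_{h_{d+1}} f(x) \Bigr|^{1/2^{d+1}}, \qquad \Delta_h f(x) := f(x+h)\overline{f(x)},$$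 where $\mathbb{E}$ denotes the average. The degree $d$ rank $\operatorname{rank}_d(P)$ is the least integer $k \geq 0$ for which there are polynomials $Q_1, \dots, Q_k : \mathbb{F}^n \to \mathbb{F}$ of degree at most $d$ and a function $B : \mathbb{F}^k \to \mathbb{F}$ with $P = B(Q_1, \dots, Q_k)$ (and it is infinite if there is no such $k$). -/

import Mathlib

open scoped BigOperators ComplexConjugate

noncomputable section

namespace PolyGowers

/-- The multiplicative derivative `Δ_h f (x) = f (x + h) * conj (f x)`. -/
def mulDeriv {V : Type*} [Add V] (h : V) (f : V → ℂ) : V → ℂ :=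
  fun x => f (x + h) * conj (f x)

/-- The iterated multiplicative derivative `Δ_{h 0} ⋯ Δ_{h (k-1)} f`. -/
def iterMulDeriv {V : Type*} [Add V] {k : ℕ} (h : Fin k → V) (f : V → ℂ) : V → ℂ :=
  (List.ofFn h).foldr mulDeriv f

/-- The iterated additive derivative `D_{h 0} ⋯ D_{h (k-1)} P`,
where `D_h P (x) = P (x + h) - P x` is Mathlib's `fwdDiff h P`. -/
def iterAddDeriv {V G : Type*} [AddCommMonoid V] [AddCommGroup G] {k : ℕ}
    (h : Fin k → V) (P : V → G) : V → G :=
  (List.ofFn h).foldr fwdDiff P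

/-- The polynomials of degree at most `d` on `𝔽_p ^ n`: the functions all of whose
`(d + 1)`-st additive derivatives vanish identically. -/
def polys (p n d : ℕ) : Set ((Fin n → ZMod p) → ZMod p) :=
  {P | ∀ h : Fin (d + 1) → (Fin n → ZMod p), iterAddDeriv h P = 0}

/-- The Gowers norm `‖f‖_{U^k}` of a complex function on a finite additive group: the
`2 ^ k`-th root of the modulus of the average over all `h_1, …, h_k, x` of
`Δ_{h_1} ⋯ Δ_{h_k} f (x)`. -/
def gowersNorm {V : Type*} [AddCommGroup V] [Fintype V] (k : ℕ) (f : V → ℂ) : ℝ :=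
  ‖𝔼 q : (Fin k → V) × V, iterMulDeriv q.1 f q.2‖ ^ ((1 : ℝ) / 2 ^ k)

/-- The phase function `e_𝔽 (P)`, where `e_𝔽 (j) = exp (2 π i j / p)` on `𝔽 = 𝔽_p`. -/
def phase {p n : ℕ} [NeZero p] (P : (Fin n → ZMod p) → ZMod p) : (Fin n → ZMod p) → ℂ :=
  fun x => ZMod.stdAddChar (P x)

/-- `P` is a function of `k` polynomials of degree at most `d`. -/
def IsFunctionOf {p n : ℕ} (d k : ℕ) (P : (Fin n → ZMod p) → ZMod p) : Prop :=
  ∃ (Q : Fin k → (Fin n → ZMod p) → ZMod p) (B : (Fin k → ZMod p) → ZMod p),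
    (∀ i, Q i ∈ polys p n d) ∧ ∀ x, P x = B (fun i => Q i x)

/-- The degree `d` rank of `P`: the least `k` such that `P` is a function of `k` polynomials of
degree at most `d`, and `∞` if there is no such `k`. -/
def rank {p n : ℕ} (d : ℕ) (P : (Fin n → ZMod p) → ZMod p) : ℕ∞ :=
  ⨅ (k : ℕ) (_ : IsFunctionOf d k P), (k : ℕ∞)

end PolyGowers

end

/-! Let `T` be the form `h ↦ D_{h_1} ⋯ D_{h_{d+1}} P`, which does not depend on the base point and
is multilinear. The `2 ^ (d + 1)`-th power of the Gowers norm is the average of the phase of `T`.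
Summing over the last variable turns it into the density of the set `Z` of `w ∈ V ^ d` with `T (w,
·) = 0` (`le_card_radical`). Since `(d + 1)!` is invertible, `P` differs from `T (x, …, x) / (d +
1)!` by a polynomial of degree at most `d` (`degLT_sub_topForm`), so it suffices to express `T (x,
…, x)` through boundedly many polynomials of degree at most `d`.

`Z` is the zero set of the polynomials `f_j (w) = T (w, e_j)`. The geometric argument needs a field
that is large compared with the codimension, whereas `p` may be small. Hence everything is extended
to `K = 𝔽_{p^k}`, with `k` depending only on `d` and `δ`. A Sidorenko-type inequality
(`card_pow_le_card_blowup`) shows that the `f_j` have at least a fraction `2 ^ (-a k ^ d)` of common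
zeros over `K`, where `2 ^ (-a) ≤ δ ^ 2 ^ (d + 1)`. The loss is governed by a polynomial in `k`,
while `|K| ≥ 2 ^ k`.

The core is `exists_hasDecomp`, by induction on the Taylor degree. By a weak Bezout theorem
(`card_nonsingular_zeros_le`), the Jacobian matrix has small rank at half of the common zeros. On a
dense subset the rank is a constant `s` and one fixed minor is nonzero; there the gradients are
combinations of `s` of them, which says that certain derived polynomials vanish. The induction
hypothesis for these, together with Euler's identity, gives the decomposition one degree higher.

Each `f_j` is homogeneous of degree `d`, so it is its own Taylor component, and `f_j = ∑ A_i B_ij`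
with `R` terms and `A_i` independent of `j`. Thus `T (x, …, x) = ∑_i A_i ∑_j x_j B_ij` on the
diagonal, with both factors of degree at most `d`. Coordinates of `K` over the prime field give `2 R
k` polynomials, and the lower-order part of `P` is one more. -/

namespace PolyGowers

/-! ### A weak Bezout theorem by dimension counting -/

section Bezout

open MvPolynomial

variable {K : Type} [Field K] {σ : Type}

/-- Restriction of a polynomial to the line `t ↦ y + t v`. -/
noncomputable def lineEval (y v : σ → K) : MvPolynomial σ K →ₐ[K] Polynomial K :=
  aeval fun a => Polynomial.C (y a) + Polynomial.C (v a) * Polynomial.X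

theorem lineEval_coeff_zero (y v : σ → K) (f : MvPolynomial σ K) :
    (lineEval y v f).coeff 0 = eval y f := by
  have h : ((Polynomial.aeval (0 : K)).comp (lineEval y v)) = aeval y := by
    apply MvPolynomial.algHom_ext
    intro i
    simp [lineEval]
  have := DFunLike.congr_fun h f
  rw [Polynomial.coeff_zero_eq_eval_zero, ← Polynomial.coe_aeval_eq_eval]
  simpa [MvPolynomial.aeval_eq_eval] using this

theorem lineEval_coeff_one [Fintype σ] (y v : σ → K) (f : MvPolynomial σ K) :
    (lineEval y v f).coeff 1 = ∑ a, v a * eval y (pderiv a f) := by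
  classical
  induction f using MvPolynomial.induction_on with
  | C r => simp [lineEval]
  | add f g hf hg => simp [hf, hg, mul_add, Finset.sum_add_distrib]
  | mul_X f i hf =>
    have hX : lineEval y v (X i) = Polynomial.C (y i) + Polynomial.C (v i) * Polynomial.X := by
      simp [lineEval]
    rw [map_mul, Polynomial.mul_coeff_one, lineEval_coeff_zero, hf, hX]
    simp only [Derivation.leibniz, pderiv_X, smul_eq_mul, map_add, map_mul, eval_X, mul_add,
      Finset.sum_add_distrib, Polynomial.coeff_add, Polynomial.coeff_C_mul,
      Polynomial.coeff_C_zero, Polynomial.coeff_X_zero, Polynomial.coeff_X_one,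
      Polynomial.coeff_C_of_ne_zero one_ne_zero]
    congr 1
    · rw [Finset.sum_eq_single i]
      · simp [mul_comm]
      · intro a _ ha
        simp [ha.symm]
      · simp
    · simp only [mul_zero, add_zero, Finset.sum_mul]
      exact Finset.sum_congr rfl fun a _ => by ring

variable [Fintype K]

theorem eq_zero_of_sum_mul_prod_pow_eq_zero {s : ℕ} (g : (Fin s → Fin (Fintype.card K)) → K)
    (hg : ∀ z : Fin s → K, ∑ α, g α * ∏ l, z l ^ (α l : ℕ) = 0) : g = 0 := by
  classical
  let m : (Fin s → Fin (Fintype.card K)) → (Fin s →₀ ℕ) :=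
    fun α => Finsupp.equivFunOnFinite.symm fun l => (α l : ℕ)
  have hm : Function.Injective m := by
    intro α β h
    have h' := Finsupp.equivFunOnFinite.symm.injective h
    funext l
    exact Fin.ext (congrFun h' l)
  have hp : (∑ α, monomial (m α) (g α) : MvPolynomial (Fin s) K) = 0 := by
    refine MvPolynomial.eq_zero_of_eval_eq_zero _ _ _ (fun z => ?_) ?_
    · rw [map_sum, ← hg z]
      refine Finset.sum_congr rfl fun α _ => ?_
      rw [eval_monomial, Finsupp.prod_fintype _ _ (by simp)]
      simp [m]
    · refine Submodule.sum_mem _ fun α _ => ?_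
      rw [mem_restrictDegree]
      intro t ht l
      rw [support_monomial] at ht
      split_ifs at ht
      · simp at ht
      · rw [Finset.mem_singleton] at ht
        subst ht
        have := (α l).2
        simp only [m, Finsupp.equivFunOnFinite_symm_apply_apply]
        omega
  funext α
  have := congrArg (coeff (m α)) hp
  rw [coeff_sum, Finset.sum_eq_single α] at this
  · simpa using this
  · intro β _ hβ
    rw [coeff_monomial, if_neg (fun h => hβ (hm h))]
  · simp

theorem degreeOf_indicator_mul_prod_lt {s e : ℕ} {h : Fin s → MvPolynomial (Fin s) K}
    (hdeg : ∀ l, (h l).totalDegree ≤ e) (y : Fin s → K) (α : Fin s → Fin (Fintype.card K))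
    (i : Fin s) :
    degreeOf i (indicator y * ∏ l, h l ^ (α l : ℕ)) < Fintype.card K * (s * e + 1) := by
  have h1 : degreeOf i (indicator y) ≤ Fintype.card K - 1 := by
    rw [degreeOf_le_iff]
    intro m hm
    exact (mem_restrictDegree _ _ _).1 (indicator_mem_restrictDegree y) m hm i
  have h2 : degreeOf i (∏ l, h l ^ (α l : ℕ)) ≤ Fintype.card K * (s * e) := by
    calc _ ≤ ∑ l : Fin s, degreeOf i (h l ^ (α l : ℕ)) := degreeOf_prod_le _ _ _
      _ ≤ ∑ l : Fin s, Fintype.card K * e := by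
        refine Finset.sum_le_sum fun l _ => ?_
        exact (degreeOf_pow_le _ _ _).trans (Nat.mul_le_mul (α l).2.le
          ((degreeOf_le_totalDegree _ _).trans (hdeg l)))
      _ = _ := by simp; ring
  have h3 := degreeOf_mul_le i (indicator y) (∏ l, h l ^ (α l : ℕ))
  have h4 : 0 < Fintype.card K := Fintype.card_pos
  rw [mul_add, mul_one]
  omega

/-- At a nonsingular zero `y` the `h l` act as local coordinates, so the products `∏ h l ^ α l` have
linearly independent leading terms at `y`; the indicators separate the different points. The
coefficients are killed by induction on `|α|`. -/
theorem indicator_mul_prod_independent {s : ℕ} {h : Fin s → MvPolynomial (Fin s) K}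
    {Y : Finset (Fin s → K)} (h0 : ∀ y ∈ Y, ∀ l, eval y (h l) = 0)
    (h1 : ∀ y ∈ Y, ∀ z : Fin s → K, ∃ v, ∀ l, (lineEval y v (h l)).coeff 1 = z l)
    (c : Y × (Fin s → Fin (Fintype.card K)) → K)
    (hc : ∑ i, c i • (indicator (i.1 : Fin s → K) * ∏ l, h l ^ (i.2 l : ℕ)) = 0) : c = 0 := by
  classical
  have key : ∀ k, ∀ i : Y × (Fin s → Fin (Fintype.card K)),
      ∑ l, (i.2 l : ℕ) = k → c i = 0 := by
    intro k
    induction k using Nat.strong_induction_on with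
    | _ k ih =>
    rintro ⟨y, α⟩ hα
    have := eq_zero_of_sum_mul_prod_pow_eq_zero
      (fun α => if ∑ l, (α l : ℕ) = k then c (y, α) else 0) (fun z => ?_)
    · have := congrFun this α
      simpa [show ∑ l, (α l : ℕ) = k from hα] using this
    -- Along `y + t v` the polynomial `h l` is `t z_l` to first order.
    obtain ⟨v, hv⟩ := h1 y y.2 z
    have hb : ∀ l, ∃ b : Polynomial K, lineEval y v (h l) = Polynomial.X * b := fun l => by
      refine Polynomial.X_dvd_iff.2 ?_
      rw [lineEval_coeff_zero, h0 y y.2]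
    choose b hb using hb
    have hbz : ∀ l, (b l).coeff 0 = z l := fun l => by
      rw [← hv l, hb l, Polynomial.coeff_X_mul]
    -- In the coefficient of `t ^ k`, terms with `|β| < k` vanish by induction and those with `|β| >
    -- k` by divisibility by a higher power of `t`. When `|β| = k` the indicator leaves only the
    -- centre `y`, contributing `c (y, β) z ^ β`.
    have hk := congrArg (fun P => (lineEval (y : Fin s → K) v P).coeff k) hc
    simp only [map_sum, map_smul, map_mul, map_prod, map_pow, map_zero, Polynomial.coeff_zero,
      Polynomial.finsetSum_coeff, Polynomial.coeff_smul, smul_eq_mul] at hk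
    rw [Fintype.sum_prod_type, Finset.sum_eq_single y] at hk
    · refine Eq.trans ?_ hk
      refine Finset.sum_congr rfl fun β _ => ?_
      have hprod : ∏ l, (lineEval (y : Fin s → K) v (h l)) ^ (β l : ℕ)
          = Polynomial.X ^ (∑ l, (β l : ℕ)) * ∏ l, b l ^ (β l : ℕ) := by
        simp_rw [hb, mul_pow, Finset.prod_mul_distrib, Finset.prod_pow_eq_pow_sum]
      rw [hprod, mul_left_comm, Polynomial.coeff_X_pow_mul']
      rcases lt_trichotomy (∑ l, (β l : ℕ)) k with hlt | heq | hgt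
      · rw [if_neg hlt.ne, ih _ hlt (y, β) rfl]; simp
      · rw [if_pos heq, if_pos heq.le, heq, Nat.sub_self, Polynomial.mul_coeff_zero,
          lineEval_coeff_zero, eval_indicator_apply_eq_one, one_mul,
          Polynomial.coeff_zero_prod]
        simp only [Polynomial.coeff_zero_eq_eval_zero, Polynomial.eval_pow] at hbz ⊢
        simp only [hbz]
      · rw [if_neg hgt.ne', if_neg hgt.not_ge]; simp
    · intro w _ hw
      refine Finset.sum_eq_zero fun β _ => ?_
      have hprod : ∏ l, (lineEval (y : Fin s → K) v (h l)) ^ (β l : ℕ)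
          = Polynomial.X ^ (∑ l, (β l : ℕ)) * ∏ l, b l ^ (β l : ℕ) := by
        simp_rw [hb, mul_pow, Finset.prod_mul_distrib, Finset.prod_pow_eq_pow_sum]
      rw [hprod, mul_left_comm, Polynomial.coeff_X_pow_mul']
      rcases lt_trichotomy (∑ l, (β l : ℕ)) k with hlt | heq | hgt
      · rw [ih _ hlt (w, β) rfl]; simp
      · rw [if_pos heq.le, heq, Nat.sub_self, Polynomial.mul_coeff_zero,
          lineEval_coeff_zero, eval_indicator_apply_eq_zero _ _ (fun h => hw (Subtype.ext h.symm))]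
        simp
      · rw [if_neg hgt.not_ge]; simp
    · simp
  funext i
  exact key _ i rfl

/-- A weak form of Bezout's theorem: `s` polynomials of degree at most `e` in `s` variables over a
finite field have at most `(s e + 1) ^ s` nonsingular common zeros. -/
theorem card_nonsingular_zeros_le {s e : ℕ} {h : Fin s → MvPolynomial (Fin s) K}
    (hdeg : ∀ l, (h l).totalDegree ≤ e)
    {Y : Finset (Fin s → K)} (h0 : ∀ y ∈ Y, ∀ l, eval y (h l) = 0)
    (h1 : ∀ y ∈ Y, ∀ z : Fin s → K, ∃ v, ∀ l, (lineEval y v (h l)).coeff 1 = z l) :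
    Y.card ≤ (s * e + 1) ^ s := by
  classical
  set q := Fintype.card K with hq
  let F : (Y × (Fin s → Fin q) → K) → MvPolynomial (Fin s) K :=
    fun c => ∑ i, c i • (indicator (i.1 : Fin s → K) * ∏ l, h l ^ (i.2 l : ℕ))
  let m : (Fin s → Fin (q * (s * e + 1))) → (Fin s →₀ ℕ) :=
    fun γ => Finsupp.equivFunOnFinite.symm fun l => (γ l : ℕ)
  have hdegF : ∀ c i, ∀ t ∈ (F c).support, t i < q * (s * e + 1) := by
    intro c i t ht
    have hpos : 0 < q * (s * e + 1) := Nat.mul_pos Fintype.card_pos (Nat.succ_pos _)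
    refine (degreeOf_lt_iff hpos).1 ?_ t ht
    refine lt_of_le_of_lt (degreeOf_sum_le _ _ _) ((Finset.sup_lt_iff hpos).2 fun j _ => ?_)
    rw [MvPolynomial.smul_eq_C_mul]
    exact (degreeOf_C_mul_le _ _ _).trans_lt (degreeOf_indicator_mul_prod_lt hdeg _ _ _)
  have hinj : Function.Injective fun (c : Y × (Fin s → Fin q) → K) =>
      fun γ => coeff (m γ) (F c) := by
    intro c c' hcc
    have hF : F c - F c' = F (c - c') := by
      simp [F, sub_smul, Finset.sum_sub_distrib]
    have hz : F (c - c') = 0 := by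
      ext t
      by_contra hne
      have ht : t ∈ (F (c - c')).support := mem_support_iff.2 hne
      let γ : Fin s → Fin (q * (s * e + 1)) := fun l => ⟨t l, hdegF _ l t ht⟩
      have hγ : m γ = t := by ext l; simp [m, γ]
      have := congrFun hcc γ
      simp only [hγ] at this
      apply hne
      rw [← hF, coeff_sub, this, sub_self, coeff_zero]
    exact sub_eq_zero.1 (indicator_mul_prod_independent h0 h1 _ hz)
  -- The `|Y| q ^ s` independent polynomials lie in a space of dimension `(q (s e + 1)) ^ s`; the
  -- factor `q ^ s` cancels.
  have hcard := Fintype.card_le_of_injective _ hinj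
  simp only [Fintype.card_fun, Fintype.card_prod, Fintype.card_fin, Fintype.card_coe] at hcard
  have hq1 : 1 < Fintype.card K := Fintype.one_lt_card
  have h2 := (Nat.pow_le_pow_iff_right hq1).1 hcard
  rw [mul_pow, mul_comm (q ^ s)] at h2
  exact Nat.le_of_mul_le_mul_right h2 (by positivity)

end Bezout

/-! ### Minors: existence, abundance, and the Schur complement identity -/

section Matrices

variable {K : Type} [Field K] {σ ι τ α : Type} [Fintype σ] [Fintype ι] [Fintype τ]

/-- `W` selects `s` independent vectors in the range of `J`, and `U` is a left inverse of `J * W`.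
-/
theorem exists_det_mul_mul_ne_zero {s : ℕ} (J : Matrix σ ι K) (hs : s ≤ J.rank) :
    ∃ (U : Matrix (Fin s) σ K) (W : Matrix ι (Fin s) K), (U * J * W).det ≠ 0 := by
  classical
  obtain ⟨b, hb⟩ := exists_linearIndependent_of_le_finrank
    (M := LinearMap.range J.mulVecLin) (R := K) hs
  choose w hw using fun l => (b l).2
  let W : Matrix ι (Fin s) K := Matrix.of fun j l => w l j
  have hcol : (J * W).col = fun l => (b l : σ → K) := by
    funext l
    rw [← hw l]
    rfl
  have hinj : LinearMap.ker (J * W).mulVecLin = ⊥ := by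
    rw [LinearMap.ker_eq_bot]
    refine Matrix.mulVec_injective_iff.2 ?_
    rw [hcol]
    exact hb.map' _ (Submodule.ker_subtype _)
  obtain ⟨g, hg⟩ := LinearMap.exists_leftInverse_of_injective _ hinj
  refine ⟨LinearMap.toMatrix' g, W, ?_⟩
  have h1 : LinearMap.toMatrix' g * (J * W) = 1 := by
    have := congrArg LinearMap.toMatrix' hg
    rw [LinearMap.toMatrix'_comp, LinearMap.toMatrix'_id] at this
    rwa [← Matrix.toLin'_apply', LinearMap.toMatrix'_toLin'] at this
  rw [Matrix.mul_assoc, h1, Matrix.det_one]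
  exact one_ne_zero

/-- A nonzero minor of full size `s` forces `U * J` to have the same kernel as `J`, so the identity
may be checked after multiplying by `U` on the left, where it is `M * adjugate M = det M`. -/
theorem det_smul_eq_of_rank_eq {s : ℕ} (J : Matrix σ ι K) (hs : J.rank = s)
    (U : Matrix (Fin s) σ K) (W : Matrix ι (Fin s) K) (hdet : (U * J * W).det ≠ 0) :
    (U * J * W).det • J = J * W * (U * J * W).adjugate * U * J := by
  classical
  have hker : LinearMap.ker J.mulVecLin = LinearMap.ker (U * J).mulVecLin := by
    refine Submodule.eq_of_le_of_finrank_le ?_ ?_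
    · intro v hv
      rw [LinearMap.mem_ker, Matrix.mulVecLin_apply] at hv ⊢
      rw [← Matrix.mulVec_mulVec, hv, Matrix.mulVec_zero]
    · have h1 := LinearMap.finrank_range_add_finrank_ker J.mulVecLin
      have h2 := LinearMap.finrank_range_add_finrank_ker (U * J).mulVecLin
      have h3 : s ≤ (U * J).rank := by
        calc s = (U * J * W).rank := by
              rw [Matrix.rank_of_isUnit _ ((Matrix.isUnit_iff_isUnit_det _).2 hdet.isUnit)]
              simp
          _ ≤ _ := Matrix.rank_mul_le_left _ _
      change J.rank + _ = _ at h1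
      change (U * J).rank + _ = _ at h2
      omega
  have hzero : ∀ v, J.mulVec ((U * J * W).det • v -
      (W * (U * J * W).adjugate * U * J).mulVec v) = 0 := by
    intro v
    rw [← Matrix.mulVecLin_apply, ← LinearMap.mem_ker, hker, LinearMap.mem_ker,
      Matrix.mulVecLin_apply, Matrix.mulVec_sub, Matrix.mulVec_mulVec, Matrix.mulVec_smul]
    have : U * J * (W * (U * J * W).adjugate * U * J) = (U * J * W).det • (U * J) := by
      calc _ = (U * J * W) * (U * J * W).adjugate * (U * J) := by simp only [Matrix.mul_assoc]
        _ = _ := by rw [Matrix.mul_adjugate, Matrix.smul_mul, Matrix.one_mul]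
    rw [this, Matrix.smul_mulVec, sub_self]
  refine Matrix.ext_of_mulVec_single fun i => ?_
  have := hzero (Pi.single i 1)
  rw [Matrix.mulVec_sub, sub_eq_zero, Matrix.mulVec_smul, Matrix.mulVec_mulVec] at this
  rw [Matrix.smul_mulVec, this]
  simp only [Matrix.mul_assoc]

variable [Fintype K]

open Classical in
-- On each line `A + t A₀` the determinant is a polynomial in `t` whose coefficient of `t ^ s` is
-- `det (A₀ * B) ≠ 0`, so it has at most `s` roots. Averaging over `A` gives the bound.
theorem card_det_mul_eq_zero_le {s : ℕ} (A₀ : Matrix (Fin s) τ K) (B : Matrix τ (Fin s) K)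
    (h : (A₀ * B).det ≠ 0) :
    (Finset.univ.filter fun A : Matrix (Fin s) τ K => (A * B).det = 0).card * Fintype.card K
      ≤ s * Fintype.card (Matrix (Fin s) τ K) := by
  have hline : ∀ A : Matrix (Fin s) τ K,
      (Finset.univ.filter fun t : K => ((A + t • A₀) * B).det = 0).card ≤ s := by
    intro A
    set P : Polynomial K := Matrix.det ((Polynomial.X : Polynomial K) •
      (A₀ * B).map Polynomial.C + (A * B).map Polynomial.C) with hP
    have hcoeff : P.coeff s = (A₀ * B).det := by
      rw [hP, ← Polynomial.coeff_det_X_add_C_card (A₀ * B) (A * B), Fintype.card_fin]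
    have hP0 : P ≠ 0 := by
      intro h0
      rw [h0, Polynomial.coeff_zero] at hcoeff
      exact h hcoeff.symm
    have hdeg : P.natDegree ≤ s := by
      exact (Polynomial.natDegree_det_X_add_C_le (A₀ * B) (A * B)).trans_eq (Fintype.card_fin s)
    refine (Finset.card_le_card (t := P.roots.toFinset) fun t ht => ?_).trans
      ((Multiset.toFinset_card_le _).trans ((Polynomial.card_roots' P).trans hdeg))
    rw [Finset.mem_filter] at ht
    rw [Multiset.mem_toFinset, Polynomial.mem_roots hP0, Polynomial.IsRoot, hP,
      ← Polynomial.coe_evalRingHom, RingHom.map_det, ← ht.2]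
    congr 1
    ext i j
    simp only [RingHom.mapMatrix_apply, Matrix.map_apply, Matrix.add_apply, Matrix.smul_apply,
      smul_eq_mul, Polynomial.eval_add, Polynomial.eval_mul, Polynomial.coe_evalRingHom, Polynomial.eval_X,
      Polynomial.eval_C, Matrix.add_mul, Matrix.smul_mul]
    ring
  have hdouble : ∑ A : Matrix (Fin s) τ K,
      (Finset.univ.filter fun t : K => ((A + t • A₀) * B).det = 0).card
      = (Finset.univ.filter fun A : Matrix (Fin s) τ K => (A * B).det = 0).card
        * Fintype.card K := by
    simp only [Finset.card_filter]
    rw [Finset.sum_comm]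
    have : ∀ t : K, ∑ A : Matrix (Fin s) τ K, (if ((A + t • A₀) * B).det = 0 then 1 else 0)
        = ∑ A : Matrix (Fin s) τ K, if (A * B).det = 0 then 1 else 0 := fun t =>
      Fintype.sum_equiv (Equiv.addRight (t • A₀)) _ _ fun A => rfl
    rw [Finset.sum_congr rfl fun t _ => this t]
    simp [mul_comm]
  rw [← hdouble]
  calc _ ≤ ∑ A : Matrix (Fin s) τ K, s := Finset.sum_le_sum fun A _ => hline A
    _ = _ := by simp [mul_comm]

open Classical in
theorem card_det_mul_eq_zero_le' {s : ℕ} (A₀ : Matrix τ (Fin s) K) (B : Matrix (Fin s) τ K)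
    (h : (B * A₀).det ≠ 0) :
    (Finset.univ.filter fun A : Matrix τ (Fin s) K => (B * A).det = 0).card * Fintype.card K
      ≤ s * Fintype.card (Matrix τ (Fin s) K) := by
  have h1 := card_det_mul_eq_zero_le A₀.transpose B.transpose
    (by rwa [← Matrix.transpose_mul, Matrix.det_transpose])
  have e : Matrix τ (Fin s) K ≃ Matrix (Fin s) τ K :=
    ⟨Matrix.transpose, Matrix.transpose, fun _ => rfl, fun _ => rfl⟩
  rw [← Fintype.card_congr e] at h1
  refine le_trans (Nat.mul_le_mul_right _ (Finset.card_le_card_of_injOn Matrix.transpose ?_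
    (Matrix.transpose_injective.injOn))) h1
  intro A hA
  simp only [Finset.coe_filter, Finset.mem_univ, true_and, Set.mem_ofPred_eq] at hA ⊢
  rwa [← Matrix.transpose_mul, Matrix.det_transpose]

open Classical in
theorem card_minor_eq_zero_le {s : ℕ} (J : Matrix σ ι K) (hs : s ≤ J.rank) :
    (Finset.univ.filter fun P : Matrix (Fin s) σ K × Matrix ι (Fin s) K =>
      (P.1 * J * P.2).det = 0).card * Fintype.card K
      ≤ 2 * s * Fintype.card (Matrix (Fin s) σ K × Matrix ι (Fin s) K) := by
  obtain ⟨U₀, W₀, h0⟩ := exists_det_mul_mul_ne_zero J hs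
  have hU := card_det_mul_eq_zero_le U₀ (J * W₀) (by rwa [← Matrix.mul_assoc])
  set bU := Finset.univ.filter fun U : Matrix (Fin s) σ K => (U * (J * W₀)).det = 0
  have hsum : (Finset.univ.filter fun P : Matrix (Fin s) σ K × Matrix ι (Fin s) K =>
      (P.1 * J * P.2).det = 0).card = ∑ U : Matrix (Fin s) σ K,
        (Finset.univ.filter fun W : Matrix ι (Fin s) K => (U * J * W).det = 0).card := by
    simp only [Finset.card_filter]
    rw [Fintype.sum_prod_type]
  rw [hsum, Finset.sum_mul]
  have hbound : ∀ U : Matrix (Fin s) σ K,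
      (Finset.univ.filter fun W : Matrix ι (Fin s) K => (U * J * W).det = 0).card
        * Fintype.card K ≤ s * Fintype.card (Matrix ι (Fin s) K) +
          (if U ∈ bU then Fintype.card (Matrix ι (Fin s) K) * Fintype.card K else 0) := by
    intro U
    split_ifs with h
    · exact le_add_left (Nat.mul_le_mul_right _ (Finset.card_le_univ _))
    · rw [add_zero]
      refine card_det_mul_eq_zero_le' W₀ (U * J) ?_
      simpa [bU, Matrix.mul_assoc] using h
  refine (Finset.sum_le_sum fun U _ => hbound U).trans ?_
  rw [Finset.sum_add_distrib, ← Finset.sum_filter, Finset.sum_const, Finset.sum_const]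
  have hf : (Finset.univ.filter fun U => U ∈ bU) = bU := by ext; simp
  rw [hf, Finset.card_univ, Fintype.card_prod, smul_eq_mul, smul_eq_mul]
  nlinarith [Nat.mul_le_mul_right (Fintype.card (Matrix ι (Fin s) K)) hU]

open Classical in
-- For each `x` at least half of all pairs `(U, W)` give a nonzero minor; by double counting some
-- single pair works for half of `B`.
theorem exists_minor_ne_zero {s : ℕ} (hq : 4 * s ≤ Fintype.card K) (J : α → Matrix σ ι K)
    (B : Finset α) (hs : ∀ x ∈ B, s ≤ (J x).rank) :
    ∃ (U : Matrix (Fin s) σ K) (W : Matrix ι (Fin s) K),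
      B.card ≤ 2 * (B.filter fun x => (U * J x * W).det ≠ 0).card := by
  set M := Fintype.card (Matrix (Fin s) σ K × Matrix ι (Fin s) K) with hM
  have hgood : ∀ x ∈ B, M ≤ 2 * (Finset.univ.filter fun P : Matrix (Fin s) σ K ×
      Matrix ι (Fin s) K => (P.1 * J x * P.2).det ≠ 0).card := by
    intro x hx
    have h1 := card_minor_eq_zero_le (J x) (hs x hx)
    have h2 := Finset.card_filter_add_card_filter_not
      (s := (Finset.univ : Finset (Matrix (Fin s) σ K × Matrix ι (Fin s) K)))
      (fun P => (P.1 * J x * P.2).det = 0)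
    rw [Finset.card_univ, ← hM] at h2
    rw [← hM] at h1
    have hq0 : 0 < Fintype.card K := Fintype.card_pos
    have h3 : 2 * (Finset.univ.filter fun P : Matrix (Fin s) σ K × Matrix ι (Fin s) K =>
        (P.1 * J x * P.2).det = 0).card ≤ M := by
      refine Nat.le_of_mul_le_mul_right (c := Fintype.card K) ?_ hq0
      nlinarith [Nat.mul_le_mul_right M hq]
    simp only [ne_eq]
    omega
  by_contra! hcon
  have hlt : ∑ P : Matrix (Fin s) σ K × Matrix ι (Fin s) K,
      2 * (B.filter fun x => (P.1 * J x * P.2).det ≠ 0).card < M * B.card := by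
    calc _ < ∑ P : Matrix (Fin s) σ K × Matrix ι (Fin s) K, B.card :=
          Finset.sum_lt_sum_of_nonempty ⟨(0, 0), Finset.mem_univ _⟩ fun P _ => hcon P.1 P.2
      _ = _ := by simp [hM]
  have hge : M * B.card ≤ ∑ x ∈ B, 2 * (Finset.univ.filter fun P : Matrix (Fin s) σ K ×
      Matrix ι (Fin s) K => (P.1 * J x * P.2).det ≠ 0).card := by
    calc _ = ∑ x ∈ B, M := by simp [mul_comm]
      _ ≤ _ := Finset.sum_le_sum hgood
  refine absurd (hge.trans_eq ?_) hlt.not_ge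
  simp only [← Finset.mul_sum, Finset.card_filter]
  rw [Finset.sum_comm]

end Matrices

/-! ### Counting zeros with a nonvanishing Jacobian minor -/

section Jacobian

open MvPolynomial

variable {K : Type} [Field K] {σ τ ι : Type}

theorem totalDegree_aeval_le {φ : σ → MvPolynomial τ K} (hφ : ∀ a, (φ a).totalDegree ≤ 1)
    (f : MvPolynomial σ K) : (aeval φ f).totalDegree ≤ f.totalDegree := by
  rw [aeval_def, eval₂_eq]
  refine totalDegree_finsetSum_le fun m hm => ?_
  rw [MvPolynomial.algebraMap_eq, ← MvPolynomial.smul_eq_C_mul]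
  refine (totalDegree_smul_le _ _).trans ((totalDegree_finsetProd _ _).trans ?_)
  refine (Finset.sum_le_sum fun a _ => (totalDegree_pow _ _).trans
    (Nat.mul_le_mul_left _ (hφ a))).trans ?_
  simp only [mul_one]
  exact le_totalDegree hm

/-- The Jacobian matrix of a family of polynomials at a point. -/
noncomputable def jac (f : ι → MvPolynomial σ K) (x : σ → K) : Matrix σ ι K :=
  Matrix.of fun a j => eval x (pderiv a (f j))

open Classical in
-- On the slice `y ↦ x₀ + y U` the `s` polynomials `∑ W j l • f j` have Jacobian `U * jac f * W`, so
-- the weak Bezout bound applies; then average over `x₀`.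
theorem card_zeros_minor_ne_zero_le [Fintype σ] [Fintype ι] [Fintype K] {s e : ℕ} {f : ι → MvPolynomial σ K}
    (hdeg : ∀ j, (f j).totalDegree ≤ e) (U : Matrix (Fin s) σ K) (W : Matrix ι (Fin s) K)
    {S : Finset (σ → K)} (h0 : ∀ x ∈ S, ∀ j, eval x (f j) = 0)
    (h1 : ∀ x ∈ S, (U * jac f x * W).det ≠ 0) :
    S.card * Fintype.card K ^ s ≤ (s * e + 1) ^ s * Fintype.card K ^ Fintype.card σ := by
  have hY : ∀ x₀ : σ → K, (Finset.univ.filter fun y : Fin s → K =>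
      x₀ + Matrix.vecMul y U ∈ S).card ≤ (s * e + 1) ^ s := by
    intro x₀
    let φ : σ → MvPolynomial (Fin s) K := fun a => C (x₀ a) + ∑ i, C (U i a) * X i
    have hφ : ∀ a, (φ a).totalDegree ≤ 1 := by
      intro a
      refine (totalDegree_add _ _).trans (max_le (by simp) (totalDegree_finsetSum_le fun i _ => ?_))
      rw [← MvPolynomial.smul_eq_C_mul]
      exact (totalDegree_smul_le _ _).trans (by simp)
    let h : Fin s → MvPolynomial (Fin s) K := fun l => aeval φ (∑ j, W j l • f j)
    have hline : ∀ y v : Fin s → K, (lineEval y v).comp (aeval φ) =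
        lineEval (x₀ + Matrix.vecMul y U) (Matrix.vecMul v U) := by
      intro y v
      refine MvPolynomial.algHom_ext fun a => ?_
      simp only [AlgHom.comp_apply, aeval_X, φ, lineEval, map_add, map_sum, map_mul,
        MvPolynomial.aeval_C, Matrix.vecMul, dotProduct, Pi.add_apply, Polynomial.algebraMap_eq]
      simp only [mul_add, Finset.sum_add_distrib, Finset.sum_mul, add_assoc]
      congr 2
      · exact Finset.sum_congr rfl fun i _ => by ring
      · exact Finset.sum_congr rfl fun i _ => by ring
    refine card_nonsingular_zeros_le (h := h) (e := e) (fun l => ?_) (fun y hy l => ?_)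
      (fun y hy z => ?_)
    · refine (totalDegree_aeval_le hφ _).trans (totalDegree_finsetSum_le fun j _ => ?_)
      exact (totalDegree_smul_le _ _).trans (hdeg j)
    · rw [Finset.mem_filter] at hy
      rw [← lineEval_coeff_zero y 0, ← AlgHom.comp_apply, hline, lineEval_coeff_zero]
      simp [h0 _ hy.2]
    · rw [Finset.mem_filter] at hy
      set x := x₀ + Matrix.vecMul y U
      have hdet := h1 x hy.2
      refine ⟨Matrix.vecMul z (U * jac f x * W)⁻¹, fun l => ?_⟩
      have hz : Matrix.vecMul (Matrix.vecMul z (U * jac f x * W)⁻¹) (U * jac f x * W) = z := by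
        rw [Matrix.vecMul_vecMul, Matrix.nonsing_inv_mul _ hdet.isUnit, Matrix.vecMul_one]
      set v := Matrix.vecMul z (U * jac f x * W)⁻¹
      rw [← AlgHom.comp_apply, hline, lineEval_coeff_one]
      conv_rhs => rw [← hz]
      rw [Matrix.mul_assoc, ← Matrix.vecMul_vecMul]
      rw [Matrix.vecMul, dotProduct]
      refine Finset.sum_congr rfl fun a _ => ?_
      congr 1
      simp [Matrix.mul_apply, jac, mul_comm, x]
  have hdouble : ∑ x₀ : σ → K, (Finset.univ.filter fun y : Fin s → K =>
      x₀ + Matrix.vecMul y U ∈ S).card = S.card * Fintype.card K ^ s := by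
    simp only [Finset.card_filter]
    rw [Finset.sum_comm]
    have : ∀ y : Fin s → K, ∑ x₀ : σ → K, (if x₀ + Matrix.vecMul y U ∈ S then 1 else 0)
        = S.card := fun y => by
      refine (Fintype.sum_equiv (Equiv.addRight (Matrix.vecMul y U)) _
        (fun x => if x ∈ S then 1 else 0) fun x => rfl).trans ?_
      simp
    rw [Finset.sum_congr rfl fun y _ => this y]
    simp [mul_comm]
  rw [← hdouble]
  calc _ ≤ ∑ x₀ : σ → K, (s * e + 1) ^ s := Finset.sum_le_sum fun x₀ _ => hY x₀
    _ = _ := by simp [mul_comm]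

end Jacobian

/-! ### Homogeneous components, Euler's identity, translation -/

section HomogeneousComponents

open MvPolynomial

variable {K : Type} [Field K] {σ τ ι : Type}

/-- Scaling the variables by an indeterminate. -/
noncomputable def scaleHom : MvPolynomial σ K →ₐ[K] Polynomial (MvPolynomial σ K) :=
  aeval fun a => Polynomial.C (X a) * Polynomial.X

theorem homogeneousComponent_monomial' (k : ℕ) (m : σ →₀ ℕ) (r : K) :
    homogeneousComponent k (monomial m r) = if k = m.degree then monomial m r else 0 :=
  homogeneousComponent_of_mem (isHomogeneous_monomial r rfl)

theorem scaleHom_coeff (k : ℕ) (f : MvPolynomial σ K) :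
    (scaleHom f).coeff k = homogeneousComponent k f := by
  classical
  induction f using MvPolynomial.induction_on' with
  | monomial m r =>
    have : scaleHom (monomial m r) = Polynomial.C (monomial m r) * Polynomial.X ^ m.degree := by
      rw [scaleHom, aeval_monomial, monomial_eq, Finsupp.degree_apply]
      simp only [Finsupp.prod, mul_pow, Finset.prod_mul_distrib, Finset.prod_pow_eq_pow_sum,
        map_mul, map_prod, map_pow, Polynomial.algebraMap_apply, MvPolynomial.algebraMap_eq,
        mul_assoc]
    rw [this, Polynomial.coeff_C_mul_X_pow, homogeneousComponent_monomial']
  | add f g hf hg => simp [hf, hg]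

theorem homogeneousComponent_mul (k : ℕ) (f g : MvPolynomial σ K) :
    homogeneousComponent k (f * g) = ∑ i ∈ Finset.range (k + 1),
      homogeneousComponent i f * homogeneousComponent (k - i) g := by
  rw [← scaleHom_coeff, map_mul, Polynomial.coeff_mul,
    Finset.Nat.sum_antidiagonal_eq_sum_range_succ_mk]
  simp only [scaleHom_coeff]

theorem homogeneousComponent_pderiv (k : ℕ) (a : σ) (f : MvPolynomial σ K) :
    homogeneousComponent k (pderiv a f) = pderiv a (homogeneousComponent (k + 1) f) := by
  classical
  induction f using MvPolynomial.induction_on' with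
  | monomial m r =>
    rw [homogeneousComponent_monomial', pderiv_monomial, homogeneousComponent_monomial']
    by_cases hma : m a = 0
    · simp [hma, apply_ite, pderiv_monomial]
    · have hle : Finsupp.single a 1 ≤ m := by
        rw [Finsupp.single_le_iff]; omega
      have hdeg : (m - Finsupp.single a 1).degree + 1 = m.degree := by
        conv_rhs => rw [← tsub_add_cancel_of_le hle, map_add, Finsupp.degree_single]
      split_ifs with h1 h2 h2
      · rw [pderiv_monomial]
      · omega
      · omega
      · simp
  | add f g hf hg => simp [hf, hg]

/-- Euler's identity, which recovers a component from the gradient as long as `k + 1` is invertible.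
-/
theorem sum_X_mul_homogeneousComponent_pderiv [Fintype σ] (k : ℕ) (f : MvPolynomial σ K) :
    ∑ a, X a * homogeneousComponent k (pderiv a f)
      = (k + 1) • homogeneousComponent (k + 1) f := by
  simp_rw [homogeneousComponent_pderiv]
  exact (homogeneousComponent_isHomogeneous (k + 1) f).sum_X_mul_pderiv

theorem totalDegree_homogeneousComponent_le (k : ℕ) (f : MvPolynomial σ K) :
    (homogeneousComponent k f).totalDegree ≤ k :=
  (homogeneousComponent_isHomogeneous k f).totalDegree_le

/-- Translation of a polynomial. -/
noncomputable def shift (p : σ → K) : MvPolynomial σ K →ₐ[K] MvPolynomial σ K :=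
  aeval fun a => X a + C (p a)

theorem homogeneousComponent_zero_shift (p : σ → K) (f : MvPolynomial σ K) :
    homogeneousComponent 0 (shift p f) = C (eval p f) := by
  rw [homogeneousComponent_zero]
  congr 1
  change constantCoeff (shift p f) = _
  have : (constantCoeff.comp (shift p : MvPolynomial σ K →ₐ[K] _).toRingHom) = eval p := by
    apply MvPolynomial.ringHom_ext <;> simp [shift]
  exact DFunLike.congr_fun this f

theorem pderiv_shift (p : σ → K) (a : σ) (f : MvPolynomial σ K) :
    pderiv a (shift p f) = shift p (pderiv a f) := by
  classical
  induction f using MvPolynomial.induction_on with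
  | C r => simp [shift]
  | add f g hf hg => simp [hf, hg]
  | mul_X f i hf =>
    have hX : shift p (X i) = X i + C (p i) := by simp [shift]
    rw [map_mul, Derivation.leibniz, Derivation.leibniz, hf, hX]
    simp only [map_add, pderiv_X, pderiv_C, smul_eq_mul, map_mul, hX, add_zero]
    by_cases h : i = a
    · subst h; simp
    · simp [h]

end HomogeneousComponents

/-! ### Decompositions into products of lower degree -/

section Decomposition

open MvPolynomial

variable {K : Type} [Field K] {σ τ ι : Type}

/-- `g` is a sum of `R` products of polynomials of degree `≤ k` with families of polynomials of
degree `< k`. -/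
def HasDecomp (k R : ℕ) (g : ι → MvPolynomial σ K) : Prop :=
  ∃ (A : Fin R → MvPolynomial σ K) (B : Fin R → ι → MvPolynomial σ K),
    (∀ i, (A i).totalDegree ≤ k) ∧ (∀ i j, (B i j).totalDegree < k) ∧
      ∀ j, g j = ∑ i, A i * B i j

theorem HasDecomp.add {k R S : ℕ} {g h : ι → MvPolynomial σ K} (hg : HasDecomp k R g)
    (hh : HasDecomp k S h) : HasDecomp k (R + S) (fun j => g j + h j) := by
  obtain ⟨A, B, hA, hB, hAB⟩ := hg
  obtain ⟨A', B', hA', hB', hAB'⟩ := hh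
  refine ⟨Fin.append A A', Fin.append B B', fun i => ?_, fun i => ?_, fun j => ?_⟩
  · refine Fin.addCases (fun i => ?_) (fun i => ?_) i <;> simp [hA, hA']
  · refine Fin.addCases (fun i => ?_) (fun i => ?_) i <;> simp [hB, hB']
  · simp [Fin.sum_univ_add, hAB, hAB']

theorem HasDecomp.smul {k R : ℕ} {g : ι → MvPolynomial σ K} (c : K) (hg : HasDecomp k R g) :
    HasDecomp k R (fun j => c • g j) := by
  obtain ⟨A, B, hA, hB, hAB⟩ := hg
  refine ⟨fun i => c • A i, B, fun i => (totalDegree_smul_le _ _).trans (hA i), hB, fun j => ?_⟩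
  simp [hAB, Finset.smul_sum]

theorem HasDecomp.mono {k R S : ℕ} (hk : 0 < k) (hRS : R ≤ S) {g : ι → MvPolynomial σ K}
    (hg : HasDecomp k R g) : HasDecomp k S g := by
  obtain ⟨T, rfl⟩ := Nat.exists_eq_add_of_le hRS
  have h0 : HasDecomp k T (fun _ : ι => (0 : MvPolynomial σ K)) :=
    ⟨fun _ => 0, fun _ _ => 0, by simp, by simpa using fun _ _ => hk, by simp⟩
  simpa using hg.add h0

theorem hasDecomp_sum {α : Type} {k : ℕ} (S : Finset α) (A : α → MvPolynomial σ K)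
    (B : α → ι → MvPolynomial σ K) (hA : ∀ i ∈ S, (A i).totalDegree ≤ k)
    (hB : ∀ i ∈ S, ∀ j, (B i j).totalDegree < k) :
    HasDecomp k S.card (fun j => ∑ i ∈ S, A i * B i j) := by
  refine ⟨fun i => A (S.equivFin.symm i), fun i => B (S.equivFin.symm i),
    fun i => hA _ (S.equivFin.symm i).2, fun i => hB _ (S.equivFin.symm i).2, fun j => ?_⟩
  beta_reduce
  rw [← Finset.sum_coe_sort S fun i => A i * B i j]
  exact (Fintype.sum_equiv S.equivFin.symm _ _ fun i => rfl).symm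

/-- Multiply by `X a` and sum over `a`. Euler's identity turns the constant term of `D` into `D₀ (k
+ 1)` times the wanted component. The `k` higher components of `D` meet components of `g j` of
degree at most `k`, and each `G l` contributes `k + 1` products; these account for the extra terms.
-/
theorem HasDecomp.of_derived [Fintype σ] {k R s : ℕ} {g : ι → MvPolynomial σ K}
    {D : MvPolynomial σ K} {D₀ : K} (hD : homogeneousComponent 0 D = C D₀) (hD₀ : D₀ ≠ 0)
    (hk : ((k + 1 : ℕ) : K) ≠ 0) (G : Fin s → MvPolynomial σ K) (H : Fin s → ι → MvPolynomial σ K)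
    (h : HasDecomp k R fun aj : σ × ι => homogeneousComponent k
      (D * pderiv aj.1 (g aj.2) - ∑ l, pderiv aj.1 (G l) * H l aj.2)) :
    HasDecomp (k + 1) (R + k + s * (k + 1)) (fun j => homogeneousComponent (k + 1) (g j)) := by
  obtain ⟨A, B, hA, hB, hAB⟩ := h
  have h1 : HasDecomp (k + 1) R (fun j => ∑ i, A i * ∑ a, X a * B i (a, j)) := by
    refine ⟨A, fun i j => ∑ a, X a * B i (a, j), fun i => (hA i).trans (Nat.le_succ k),
      fun i j => ?_, fun j => rfl⟩
    refine Nat.lt_succ_of_le (totalDegree_finsetSum_le fun a _ => ?_)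
    refine (totalDegree_mul _ _).trans ?_
    rw [totalDegree_X]
    have := hB i (a, j)
    omega
  have h2 := hasDecomp_sum (k := k + 1) (Finset.range k)
    (fun i => homogeneousComponent (i + 1) D)
    (fun i j => (k - (i + 1) + 1) • homogeneousComponent (k - (i + 1) + 1) (g j))
    (fun i hi => (totalDegree_homogeneousComponent_le _ _).trans (by
      rw [Finset.mem_range] at hi; omega))
    (fun i hi j => lt_of_le_of_lt ((totalDegree_smul_le _ _).trans
      (totalDegree_homogeneousComponent_le _ _)) (by rw [Finset.mem_range] at hi; omega))
  have h3 := hasDecomp_sum (k := k + 1) ((Finset.univ : Finset (Fin s)) ×ˢ Finset.range (k + 1))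
    (fun li => (li.2 + 1) • homogeneousComponent (li.2 + 1) (G li.1))
    (fun li j => homogeneousComponent (k - li.2) (H li.1 j))
    (fun li hi => ((totalDegree_smul_le _ _).trans
      (totalDegree_homogeneousComponent_le _ _)).trans (by
        rw [Finset.mem_product, Finset.mem_range] at hi; omega))
    (fun li hi j => lt_of_le_of_lt (totalDegree_homogeneousComponent_le _ _) (by omega))
  have h4 := ((h1.add (h2.smul (-1))).add h3).smul (D₀ * ((k + 1 : ℕ) : K))⁻¹
  rw [Finset.card_range, Finset.card_product, Finset.card_univ, Fintype.card_fin,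
    Finset.card_range] at h4
  convert h4 using 2 with j
  have hkey : ∑ a, X a * homogeneousComponent k
      (D * pderiv a (g j) - ∑ l, pderiv a (G l) * H l j) = ∑ i, A i * ∑ a, X a * B i (a, j) := by
    simp_rw [fun a => hAB (a, j), Finset.mul_sum]
    rw [Finset.sum_comm]
    exact Finset.sum_congr rfl fun i _ => Finset.sum_congr rfl fun a _ => by ring
  have hL1 : ∑ a, X a * homogeneousComponent k (D * pderiv a (g j)) =
      ∑ i ∈ Finset.range k, homogeneousComponent (i + 1) D *
        ((k - (i + 1) + 1) • homogeneousComponent (k - (i + 1) + 1) (g j)) +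
      C D₀ * ((k + 1) • homogeneousComponent (k + 1) (g j)) := by
    simp_rw [homogeneousComponent_mul, Finset.mul_sum]
    rw [Finset.sum_comm, Finset.sum_range_succ']
    simp_rw [mul_left_comm (X _ : MvPolynomial σ K), ← Finset.mul_sum,
      sum_X_mul_homogeneousComponent_pderiv]
    rw [hD, Nat.sub_zero]
  have hL2 : ∑ a, X a * homogeneousComponent k (∑ l, pderiv a (G l) * H l j) =
      ∑ li ∈ (Finset.univ : Finset (Fin s)) ×ˢ Finset.range (k + 1),
        (li.2 + 1) • homogeneousComponent (li.2 + 1) (G li.1) *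
          homogeneousComponent (k - li.2) (H li.1 j) := by
    rw [Finset.sum_product]
    simp_rw [map_sum, homogeneousComponent_mul, Finset.mul_sum]
    rw [Finset.sum_comm]
    refine Finset.sum_congr rfl fun l _ => ?_
    rw [Finset.sum_comm]
    refine Finset.sum_congr rfl fun i _ => ?_
    simp_rw [← mul_assoc, ← Finset.sum_mul, sum_X_mul_homogeneousComponent_pderiv]
  simp_rw [map_sub, mul_sub, Finset.sum_sub_distrib] at hkey
  rw [hL1, hL2] at hkey
  rw [← hkey, eq_inv_smul_iff₀ (mul_ne_zero hD₀ hk), mul_smul, MvPolynomial.smul_eq_C_mul]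
  have : ((k + 1 : ℕ) : K) • homogeneousComponent (k + 1) (g j)
      = (k + 1) • homogeneousComponent (k + 1) (g j) := Nat.cast_smul_eq_nsmul K _ _
  rw [this, neg_smul, one_smul]
  abel

end Decomposition

/-! ### The derived polynomials and their degrees -/

section Derived

open MvPolynomial

variable {K : Type} [Field K] {σ τ ι : Type}

theorem totalDegree_pderiv_le (a : σ) (f : MvPolynomial σ K) :
    (pderiv a f).totalDegree ≤ f.totalDegree := by
  classical
  conv_lhs => rw [f.as_sum, map_sum]
  refine totalDegree_finsetSum_le fun m hm => ?_
  rw [pderiv_monomial]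
  refine (totalDegree_monomial_le _ _).trans (le_trans ?_ (le_totalDegree hm))
  change (m - Finsupp.single a 1).degree ≤ m.degree
  exact Finsupp.degree_mono tsub_le_self

theorem totalDegree_det_le {s b : ℕ} (M : Matrix (Fin s) (Fin s) (MvPolynomial σ K))
    (hM : ∀ i j, (M i j).totalDegree ≤ b) : M.det.totalDegree ≤ s * b := by
  rw [Matrix.det_apply]
  refine totalDegree_finsetSum_le fun π _ => ?_
  have h : (∏ i, M (π i) i).totalDegree ≤ s * b :=
    (totalDegree_finsetProd _ _).trans
      ((Finset.sum_le_sum fun i _ => hM (π i) i).trans_eq (by simp))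
  rcases Int.units_eq_one_or (Equiv.Perm.sign π) with h' | h' <;> simpa [h'] using h

theorem totalDegree_adjugate_le {s b : ℕ} (M : Matrix (Fin s) (Fin s) (MvPolynomial σ K))
    (hM : ∀ i j, (M i j).totalDegree ≤ b) (i j : Fin s) :
    (M.adjugate i j).totalDegree ≤ s * b := by
  rw [Matrix.adjugate_apply]
  refine totalDegree_det_le _ fun i' j' => ?_
  rw [Matrix.updateRow_apply]
  split_ifs
  · rw [Pi.single_apply]; split_ifs <;> simp
  · exact hM _ _

variable [Fintype σ] [Fintype ι]

/-- The minor `U (jac f) W` as a matrix of polynomials. -/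
noncomputable def polyMinor {s : ℕ} (f : ι → MvPolynomial σ K) (U : Matrix (Fin s) σ K)
    (W : Matrix ι (Fin s) K) : Matrix (Fin s) (Fin s) (MvPolynomial σ K) :=
  Matrix.of fun i l => ∑ a, U i a • pderiv a (∑ j, W j l • f j)

/-- The rows `U (jac f)` weighted by the adjugate of the minor `U (jac f) W`. -/
noncomputable def adjRow {s : ℕ} (f : ι → MvPolynomial σ K) (U : Matrix (Fin s) σ K)
    (W : Matrix ι (Fin s) K) (l : Fin s) (j : ι) : MvPolynomial σ K :=
  ∑ i, (polyMinor f U W).adjugate l i * ∑ a, U i a • pderiv a (f j)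

/-- The entries of the Schur complement of `U (jac f) W` in the Jacobian matrix, cleared of
denominators. They vanish wherever the Jacobian matrix has rank `s` and the minor is nonzero. -/
noncomputable def derived {s : ℕ} (f : ι → MvPolynomial σ K) (U : Matrix (Fin s) σ K)
    (W : Matrix ι (Fin s) K) (aj : σ × ι) : MvPolynomial σ K :=
  (polyMinor f U W).det * pderiv aj.1 (f aj.2) -
    ∑ l, pderiv aj.1 (∑ j, W j l • f j) * adjRow f U W l aj.2

variable {s b : ℕ} {f : ι → MvPolynomial σ K} (U : Matrix (Fin s) σ K) (W : Matrix ι (Fin s) K)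

theorem totalDegree_polyMinor_le (hf : ∀ j, (f j).totalDegree ≤ b) (i l : Fin s) :
    (polyMinor f U W i l).totalDegree ≤ b := by
  refine totalDegree_finsetSum_le fun a _ => (totalDegree_smul_le _ _).trans ?_
  refine (totalDegree_pderiv_le _ _).trans (totalDegree_finsetSum_le fun j _ => ?_)
  exact (totalDegree_smul_le _ _).trans (hf j)

theorem totalDegree_derived_le (hf : ∀ j, (f j).totalDegree ≤ b) (aj : σ × ι) :
    (derived f U W aj).totalDegree ≤ (s + 2) * b := by
  have hM := totalDegree_polyMinor_le U W hf
  have hp : ∀ a j, (pderiv a (f j)).totalDegree ≤ b := fun a j =>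
    (totalDegree_pderiv_le _ _).trans (hf j)
  refine (totalDegree_sub _ _).trans (max_le ?_ (totalDegree_finsetSum_le fun l _ => ?_))
  · refine (totalDegree_mul _ _).trans ?_
    have := totalDegree_det_le _ hM
    have := hp aj.1 aj.2
    nlinarith
  · refine (totalDegree_mul _ _).trans ?_
    have h1 : (pderiv aj.1 (∑ j, W j l • f j)).totalDegree ≤ b :=
      (totalDegree_pderiv_le _ _).trans (totalDegree_finsetSum_le fun j _ =>
        (totalDegree_smul_le _ _).trans (hf j))
    have h2 : (adjRow f U W l aj.2).totalDegree ≤ s * b + b := by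
      refine totalDegree_finsetSum_le fun i _ => (totalDegree_mul _ _).trans ?_
      exact add_le_add (totalDegree_adjugate_le _ hM _ _) (totalDegree_finsetSum_le fun a _ =>
        (totalDegree_smul_le _ _).trans (hp a _))
    nlinarith

theorem eval_polyMinor (x : σ → K) :
    (eval x).mapMatrix (polyMinor f U W) = U * jac f x * W := by
  ext i l
  rw [Matrix.mul_assoc]
  simp only [polyMinor, jac, RingHom.mapMatrix_apply, Matrix.map_apply, Matrix.of_apply, map_sum,
    Derivation.map_smul, smul_eval, Matrix.mul_apply]
  exact Finset.sum_congr rfl fun a _ => congrArg _ (Finset.sum_congr rfl fun j _ => mul_comm _ _)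

theorem eval_det_polyMinor (x : σ → K) :
    eval x (polyMinor f U W).det = (U * jac f x * W).det := by
  rw [RingHom.map_det, eval_polyMinor]

theorem eval_derived_eq_zero {x : σ → K} (hx : (jac f x).rank = s)
    (hdet : (U * jac f x * W).det ≠ 0) (aj : σ × ι) : eval x (derived f U W aj) = 0 := by
  obtain ⟨a, j⟩ := aj
  have h := congrFun (congrFun (det_smul_eq_of_rank_eq (jac f x) hx U W hdet) a) j
  rw [derived, map_sub, map_mul, eval_det_polyMinor, sub_eq_zero]
  refine Eq.trans ?_ (h.trans ?_)
  · simp [jac]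
  · rw [Matrix.mul_assoc, Matrix.mul_assoc, Matrix.mul_apply, map_sum]
    refine Finset.sum_congr rfl fun l _ => ?_
    rw [map_mul]
    congr 1
    · simp [jac, Matrix.mul_apply, mul_comm]
    · rw [Matrix.mul_apply, adjRow, map_sum]
      refine Finset.sum_congr rfl fun i _ => ?_
      rw [map_mul]
      congr 1
      · rw [← eval_polyMinor, ← RingHom.map_adjugate]; rfl
      · simp [jac, Matrix.mul_apply]

theorem shift_derived (p : σ → K) (aj : σ × ι) : shift p (derived f U W aj) =
    shift p (polyMinor f U W).det * pderiv aj.1 (shift p (f aj.2)) -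
      ∑ l, pderiv aj.1 (shift p (∑ j, W j l • f j)) * shift p (adjRow f U W l aj.2) := by
  simp only [derived, map_sub, map_mul, pderiv_shift]
  rw [map_sum]
  simp only [map_mul]

end Derived

/-! ### Many common zeros force a bounded decomposition -/

section MainInduction

open MvPolynomial

variable {K : Type} [Field K] [Fintype K] {σ ι : Type} [Fintype σ] [Fintype ι]

open Classical in
-- With `s = 2 b + 2`, the zeros with one fixed nonzero `s`-minor have density at most `((s b + 1) /
-- q) ^ s`. Since `4 (s b + 1) ^ 2 ≤ q`, this is at most a quarter of `q ^ (-b)`.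
theorem card_rank_ge_le {b : ℕ} (hb : 3 ≤ b) (hq : b ^ 8 ≤ Fintype.card K)
    {f : ι → MvPolynomial σ K} (hdeg : ∀ j, (f j).totalDegree ≤ b) {A : Finset (σ → K)}
    (h0 : ∀ x ∈ A, ∀ j, eval x (f j) = 0)
    (hA : Fintype.card K ^ Fintype.card σ ≤ A.card * Fintype.card K ^ b) :
    2 * (A.filter fun x => 2 * b + 2 ≤ (jac f x).rank).card ≤ A.card := by
  set q := Fintype.card K with hqdef
  set s := 2 * b + 2 with hs
  set B := A.filter fun x => s ≤ (jac f x).rank with hB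
  have hsb : s * b + 1 ≤ b ^ 3 + 1 := by nlinarith [Nat.mul_le_mul hb hb]
  have h4 : 4 * (s * b + 1) ^ 2 ≤ q := by
    calc 4 * (s * b + 1) ^ 2 ≤ 4 * (b ^ 3 + 1) ^ 2 := by gcongr
      _ = (2 * (b ^ 3 + 1)) ^ 2 := by ring
      _ ≤ (b ^ 4) ^ 2 := by
        gcongr
        have : 27 ≤ b ^ 3 := by simpa using Nat.pow_le_pow_left hb 3
        have : b ^ 4 = b ^ 3 * b := by ring
        nlinarith
      _ = b ^ 8 := by ring
      _ ≤ q := hq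
  have hqs : 4 * s ≤ q := by
    have h1 : s ≤ s * b + 1 := (Nat.le_mul_of_pos_right s (by omega)).trans (Nat.le_succ _)
    have h2 : s * b + 1 ≤ (s * b + 1) ^ 2 := Nat.le_self_pow (by norm_num) _
    omega
  obtain ⟨U, W, hUW⟩ := exists_minor_ne_zero (σ := σ) (ι := ι) hqs (fun x => jac f x) B
    (fun x hx => (Finset.mem_filter.1 hx).2)
  set S := B.filter fun x => (U * jac f x * W).det ≠ 0
  have hS := card_zeros_minor_ne_zero_le hdeg U W (S := S)
    (fun x hx => h0 x (Finset.mem_filter.1 (Finset.mem_filter.1 hx).1).1)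
    (fun x hx => (Finset.mem_filter.1 hx).2)
  rw [← hqdef] at hS
  have hq0 : 0 < q := Fintype.card_pos
  have h5 : 4 * (s * b + 1) ^ s ≤ q ^ (b + 2) := by
    calc 4 * (s * b + 1) ^ s = 4 * ((s * b + 1) ^ 2) ^ (b + 1) := by rw [← pow_mul]; congr 2
      _ ≤ q * q ^ (b + 1) := by
        gcongr
        · nlinarith
        · nlinarith
      _ = q ^ (b + 2) := by ring
  have h6 : 4 * S.card ≤ A.card := by
    refine Nat.le_of_mul_le_mul_right (c := q ^ s) ?_ (by positivity)
    calc 4 * S.card * q ^ s ≤ 4 * ((s * b + 1) ^ s * q ^ Fintype.card σ) := by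
          rw [mul_assoc]; gcongr
      _ = 4 * (s * b + 1) ^ s * q ^ Fintype.card σ := by ring
      _ ≤ q ^ (b + 2) * (A.card * q ^ b) := by gcongr
      _ = A.card * q ^ s := by rw [hs]; ring
  omega

open Classical in
theorem exists_subset_rank_eq {b : ℕ} (hb : 3 ≤ b) (hq : b ^ 8 ≤ Fintype.card K)
    {f : ι → MvPolynomial σ K} (hdeg : ∀ j, (f j).totalDegree ≤ b) {A : Finset (σ → K)}
    (h0 : ∀ x ∈ A, ∀ j, eval x (f j) = 0)
    (hA : Fintype.card K ^ Fintype.card σ ≤ A.card * Fintype.card K ^ b) :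
    ∃ s < 2 * b + 2, ∃ (U : Matrix (Fin s) σ K) (W : Matrix ι (Fin s) K), ∃ A' ⊆ A,
      (∀ x ∈ A', (jac f x).rank = s ∧ (U * jac f x * W).det ≠ 0) ∧
        Fintype.card K ^ Fintype.card σ ≤ A'.card * Fintype.card K ^ (b + 1) := by
  have hhalf := card_rank_ge_le hb hq hdeg h0 hA
  set q := Fintype.card K with hqdef
  have hq4 : 4 * (2 * b + 2) ≤ q := by
    have : b ^ 8 = b ^ 2 * b ^ 6 := by ring
    have h6 : 3 ^ 6 ≤ b ^ 6 := Nat.pow_le_pow_left hb 6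
    nlinarith [Nat.mul_le_mul hb hb]
  have hsplit := Finset.card_filter_add_card_filter_not (s := A)
    (fun x => 2 * b + 2 ≤ (jac f x).rank)
  set A₁ := A.filter fun x => ¬ 2 * b + 2 ≤ (jac f x).rank
  have hpig : ∃ s ∈ Finset.range (2 * b + 2),
      A₁.card ≤ (2 * b + 2) * (A₁.filter fun x => (jac f x).rank = s).card := by
    by_contra! hcon
    have hsum : A₁.card = ∑ s ∈ Finset.range (2 * b + 2),
        (A₁.filter fun x => (jac f x).rank = s).card :=
      Finset.card_eq_sum_card_fiberwise fun x hx => by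
        simpa [A₁] using (Finset.mem_filter.1 hx).2
    have := Finset.sum_lt_sum_of_nonempty (s := Finset.range (2 * b + 2)) (by simp) hcon
    rw [← Finset.mul_sum, ← hsum, Finset.sum_const, Finset.card_range, smul_eq_mul] at this
    exact lt_irrefl _ this
  obtain ⟨s, hs, hcard⟩ := hpig
  rw [Finset.mem_range] at hs
  obtain ⟨U, W, hUW⟩ := exists_minor_ne_zero (σ := σ) (ι := ι) (by omega : 4 * s ≤ q)
    (fun x => jac f x) (A₁.filter fun x => (jac f x).rank = s)
    (fun x hx => (Finset.mem_filter.1 hx).2.ge)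
  refine ⟨s, hs, U, W, (A₁.filter fun x => (jac f x).rank = s).filter
    fun x => (U * jac f x * W).det ≠ 0, ?_, ?_, ?_⟩
  · exact (Finset.filter_subset _ _).trans
      ((Finset.filter_subset _ _).trans (Finset.filter_subset _ _))
  · intro x hx
    rw [Finset.mem_filter, Finset.mem_filter] at hx
    exact ⟨hx.1.2, hx.2⟩
  · set c := ((A₁.filter fun x => (jac f x).rank = s).filter
      fun x => (U * jac f x * W).det ≠ 0).card
    -- The losses are `2` for bounded rank, `2 b + 2` for the choice of rank and `2` for the choice
    -- of minor; their product is at most `q`.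
    have hAc : A.card ≤ c * q := by
      have : A.card ≤ 2 * A₁.card := by omega
      nlinarith
    calc q ^ Fintype.card σ ≤ A.card * q ^ b := hA
      _ ≤ c * q * q ^ b := by gcongr
      _ = c * q ^ (b + 1) := by ring

/-- If a family of polynomials of bounded degree has many common zeros over a large enough finite
field, then at one of these zeros its degree `k` Taylor coefficients have bounded rank. -/
theorem exists_hasDecomp (k : ℕ) : ∀ b : ℕ, 3 ≤ b → ∃ R : ℕ, ∀ (K : Type) [Field K] [Fintype K]
    (σ ι : Type) [Fintype σ] [Fintype ι], (k.factorial : K) ≠ 0 →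
    b ^ (8 * 3 ^ k) ≤ Fintype.card K → ∀ f : ι → MvPolynomial σ K,
    (∀ j, (f j).totalDegree ≤ b) → ∀ A : Finset (σ → K), (∀ x ∈ A, ∀ j, eval x (f j) = 0) →
    Fintype.card K ^ Fintype.card σ ≤ A.card * Fintype.card K ^ b →
    ∃ p ∈ A, HasDecomp k R fun j => homogeneousComponent k (shift p (f j)) := by
  induction k with
  | zero =>
    intro b _
    -- In degree `0` the Taylor component at `p` is `f j (p) = 0`, so no terms are needed.
    refine ⟨0, fun K _ _ σ ι _ _ _ _ f _ A h0 hA => ?_⟩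
    have hA0 : A.Nonempty := by
      rw [← Finset.card_pos]
      by_contra h
      rw [Nat.eq_zero_of_not_pos h, zero_mul] at hA
      exact absurd hA (not_le.2 (pow_pos Fintype.card_pos _))
    obtain ⟨p, hp⟩ := hA0
    refine ⟨p, hp, fun _ => 0, fun _ _ => 0, fun i => i.elim0, fun i => i.elim0, fun j => ?_⟩
    beta_reduce
    rw [homogeneousComponent_zero_shift, h0 p hp, C_0, Finset.univ_eq_empty, Finset.sum_empty]
  | succ k ih =>
    intro b hb
    have hb3 : b ≤ b ^ 3 := Nat.le_self_pow (by norm_num) b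
    -- `b ^ 3` dominates both the degree `(s + 2) b` of the derived polynomials and the new density
    -- exponent `b + 1`.
    obtain ⟨R, hR⟩ := ih (b ^ 3) (hb.trans hb3)
    refine ⟨R + k + (2 * b + 2) * (k + 1), fun K _ _ σ ι _ _ hk hq f hdeg A h0 hA => ?_⟩
    have hq8 : b ^ 8 ≤ Fintype.card K :=
      (Nat.pow_le_pow_right (by omega) (Nat.le_mul_of_pos_right 8 (by positivity))).trans hq
    obtain ⟨s, hs, U, W, A', hA'A, hA', hcard⟩ := exists_subset_rank_eq hb hq8 hdeg h0 hA
    rw [Nat.factorial_succ, Nat.cast_mul] at hk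
    have hb9 : 9 ≤ b ^ 2 := by simpa using Nat.pow_le_pow_left hb 2
    obtain ⟨p, hp, hdec⟩ := hR K σ (σ × ι) (right_ne_zero_of_mul hk)
      (by rw [← pow_mul]; refine le_trans (le_of_eq ?_) hq; congr 1; ring) (derived f U W)
      (fun aj => (totalDegree_derived_le U W hdeg aj).trans (by
        rw [pow_succ b 2]; exact Nat.mul_le_mul_right _ (by nlinarith))) A'
      (fun x hx => eval_derived_eq_zero U W (hA' x hx).1 (hA' x hx).2)
      (hcard.trans (Nat.mul_le_mul_left _ (Nat.pow_le_pow_right Fintype.card_pos (by nlinarith))))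
    refine ⟨p, hA'A hp, ?_⟩
    have hstep : HasDecomp (k + 1) (R + k + s * (k + 1))
        (fun j => homogeneousComponent (k + 1) (shift p (f j))) := by
      refine HasDecomp.of_derived (D := shift p (polyMinor f U W).det)
        (homogeneousComponent_zero_shift _ _)
        (by rw [eval_det_polyMinor]; exact (hA' p hp).2) (left_ne_zero_of_mul hk)
        (fun l => shift p (∑ j, W j l • f j)) (fun l j => shift p (adjRow f U W l j)) ?_
      simpa only [shift_derived] using hdec
    exact hstep.mono (Nat.succ_pos k) (by gcongr)

end MainInduction

/-! ### Additive derivatives and the top-order form -/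

section Differences

variable {V G H : Type} [AddCommGroup V] [AddCommGroup G] [AddCommGroup H]

/-- All `n`-fold additive derivatives of `f` vanish. -/
def DegLT (n : ℕ) (f : V → G) : Prop := ∀ h : Fin n → V, iterAddDeriv h f = 0

theorem iterAddDeriv_succ {n : ℕ} (h : Fin (n + 1) → V) (f : V → G) :
    iterAddDeriv h f = fwdDiff (h 0) (iterAddDeriv (Fin.tail h) f) := by
  simp only [iterAddDeriv, List.ofFn_succ, List.foldr_cons]
  rfl

theorem iterAddDeriv_succ' {n : ℕ} (h : Fin (n + 1) → V) (f : V → G) :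
    iterAddDeriv h f = iterAddDeriv (Fin.init h) (fwdDiff (h (Fin.last n)) f) := by
  simp only [iterAddDeriv, List.ofFn_succ', List.concat_eq_append, List.foldr_append,
    List.foldr_cons, List.foldr_nil]
  rfl

theorem iterAddDeriv_add {n : ℕ} (h : Fin n → V) (f g : V → G) :
    iterAddDeriv h (f + g) = iterAddDeriv h f + iterAddDeriv h g := by
  induction n with
  | zero => rfl
  | succ n ih => simp only [iterAddDeriv_succ, ih, fwdDiff_add]

/-- `iterAddDeriv` as an additive homomorphism. -/
def iterAddDerivHom {n : ℕ} (h : Fin n → V) : (V → G) →+ (V → G) :=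
  AddMonoidHom.mk' (iterAddDeriv h) (iterAddDeriv_add h)

theorem iterAddDeriv_comp_hom {n : ℕ} (h : Fin n → V) (φ : G →+ H) (f : V → G) :
    iterAddDeriv h (fun x => φ (f x)) = fun x => φ (iterAddDeriv h f x) := by
  induction n with
  | zero => rfl
  | succ n ih =>
    rw [iterAddDeriv_succ, iterAddDeriv_succ, ih]
    funext x
    simp [fwdDiff]

theorem iterAddDeriv_comp_nsmul {n : ℕ} (t : ℕ) (h : Fin n → V) (f : V → G) :
    iterAddDeriv h (fun x => f (t • x)) = fun x => iterAddDeriv (fun i => t • h i) f (t • x) := by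
  induction n with
  | zero => rfl
  | succ n ih =>
    rw [iterAddDeriv_succ, iterAddDeriv_succ, ih]
    funext x
    simp only [fwdDiff, smul_add]
    rfl

theorem iterAddDeriv_const {k : ℕ} (y : V) (f : V → G) :
    iterAddDeriv (fun _ : Fin k => y) f = (fwdDiff y)^[k] f := by
  induction k with
  | zero => rfl
  | succ k ih => rw [iterAddDeriv_succ, Function.iterate_succ_apply', ← ih]; rfl

theorem degLT_zero_iff {f : V → G} : DegLT 0 f ↔ f = 0 :=
  ⟨fun h => h Fin.elim0, fun h _ => h⟩

theorem degLT_succ_iff {n : ℕ} {f : V → G} : DegLT (n + 1) f ↔ ∀ v, DegLT n (fwdDiff v f) := by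
  constructor
  · intro hf v h
    have := hf (Fin.snoc h v)
    rw [iterAddDeriv_succ'] at this
    simpa using this
  · intro hf h
    rw [iterAddDeriv_succ']
    exact hf _ _

theorem DegLT.succ {n : ℕ} {f : V → G} (hf : DegLT n f) : DegLT (n + 1) f := by
  intro h
  rw [iterAddDeriv_succ, hf]
  funext x
  simp [fwdDiff]

theorem DegLT.mono {m n : ℕ} (hmn : m ≤ n) {f : V → G} (hf : DegLT m f) : DegLT n f := by
  induction hmn with
  | refl => exact hf
  | step _ ih => exact ih.succ

theorem DegLT.add {n : ℕ} {f g : V → G} (hf : DegLT n f) (hg : DegLT n g) : DegLT n (f + g) :=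
  fun h => by rw [iterAddDeriv_add, hf, hg, add_zero]

theorem degLT_zero_fun (n : ℕ) : DegLT n (0 : V → G) :=
  fun h => map_zero (iterAddDerivHom h)

theorem degLT_sum {α : Type} {n : ℕ} (S : Finset α) {f : α → V → G} (hf : ∀ i ∈ S, DegLT n (f i)) :
    DegLT n (∑ i ∈ S, f i) := by
  intro h
  change iterAddDerivHom h _ = 0
  rw [map_sum]
  exact Finset.sum_eq_zero fun i hi => hf i hi h

theorem DegLT.comp_hom {n : ℕ} {f : V → G} (hf : DegLT n f) (φ : G →+ H) :
    DegLT n (fun x => φ (f x)) := by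
  intro h
  rw [iterAddDeriv_comp_hom, hf]
  funext x
  simp

theorem degLT_const (c : G) : DegLT 1 (fun _ : V => c) := by
  rw [degLT_succ_iff]
  intro v
  rw [degLT_zero_iff]
  simp [funext_iff]

theorem degLT_hom (φ : V →+ G) : DegLT 2 (fun x => φ x) := by
  rw [degLT_succ_iff]
  intro v
  have : fwdDiff v (fun x => φ x) = fun _ => φ v := by funext x; simp [fwdDiff]
  rw [this]
  exact degLT_const _

/-- `DegLT n` means degree at most `n - 1`, so the numerical condition is additivity of degrees.
Induction via the Leibniz rule for differences. -/
theorem DegLT.mul {R : Type} [CommRing R] {N a b : ℕ} {f g : V → R} (hf : DegLT a f)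
    (hg : DegLT b g) (hab : a + b ≤ N + 1) : DegLT N (f * g) := by
  induction N generalizing a b f g with
  | zero =>
    rcases (by omega : a = 0 ∨ b = 0) with rfl | rfl
    · rw [degLT_zero_iff.1 hf, zero_mul]; exact degLT_zero_fun 0
    · rw [degLT_zero_iff.1 hg, mul_zero]; exact degLT_zero_fun 0
  | succ N ih =>
    rcases a with _ | a
    · rw [degLT_zero_iff.1 hf, zero_mul]; exact degLT_zero_fun _
    rcases b with _ | b
    · rw [degLT_zero_iff.1 hg, mul_zero]; exact degLT_zero_fun _
    rw [degLT_succ_iff]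
    intro v
    have hfv := degLT_succ_iff.1 hf v
    have hgv := degLT_succ_iff.1 hg v
    rw [← smul_eq_mul, fwdDiff_smul]
    simp only [smul_eq_mul]
    exact ((ih hfv hg (by omega)).add (ih hf hgv (by omega))).add (ih hfv hgv (by omega))

theorem DegLT.pow {R : Type} [CommRing R] {a : ℕ} {f : V → R} (hf : DegLT (a + 1) f) (n : ℕ) :
    DegLT (n * a + 1) (f ^ n) := by
  induction n with
  | zero => rw [pow_zero, zero_mul]; exact degLT_const 1
  | succ n ih => rw [pow_succ]; exact ih.mul hf (by ring_nf; omega)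

theorem degLT_prod {R α : Type} [CommRing R] (S : Finset α) {f : α → V → R} {a : α → ℕ}
    (hf : ∀ i ∈ S, DegLT (a i + 1) (f i)) : DegLT (∑ i ∈ S, a i + 1) (∏ i ∈ S, f i) := by
  classical
  induction S using Finset.induction_on with
  | empty => exact degLT_const 1
  | insert i S hi ih =>
    rw [Finset.sum_insert hi, Finset.prod_insert hi]
    exact (hf i (Finset.mem_insert_self i S)).mul
      (ih fun j hj => hf j (Finset.mem_insert_of_mem hj)) (by omega)

theorem degLT_eval {R σ : Type} [CommRing R] (Q : MvPolynomial σ R) {y : σ → V → R}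
    (hy : ∀ i, DegLT 2 (y i)) : DegLT (Q.totalDegree + 1) (fun x => Q.eval fun i => y i x) := by
  have : (fun x => Q.eval fun i => y i x) =
      ∑ m ∈ Q.support, (fun _ => Q.coeff m) * ∏ i ∈ m.support, y i ^ m i := by
    funext x
    simp [MvPolynomial.eval_eq]
  rw [this]
  refine degLT_sum _ fun m hm => ?_
  have h1 : DegLT (∑ i ∈ m.support, m i + 1) (∏ i ∈ m.support, y i ^ m i) :=
    degLT_prod _ fun i _ => by simpa using (hy i).pow (a := 1) (m i)
  have h2 : ∑ i ∈ m.support, m i ≤ Q.totalDegree := MvPolynomial.le_totalDegree hm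
  exact (degLT_const _).mul h1 (by omega)

theorem DegLT.iterAddDeriv_eq {k : ℕ} {f : V → G} (hf : DegLT (k + 1) f) (h : Fin k → V) (x : V) :
    iterAddDeriv h f x = iterAddDeriv h f 0 := by
  have := congrFun (hf (Fin.cons x h)) 0
  rw [iterAddDeriv_succ] at this
  simpa [fwdDiff, sub_eq_zero] using this

/-- `D_{a+b} = D_a + D_b + D_a D_b`, and the last term takes one derivative too many to survive. -/
theorem DegLT.iterAddDeriv_update_add {k : ℕ} {f : V → G} (hf : DegLT (k + 1) f) (h : Fin k → V)
    (i : Fin k) (a b : V) : iterAddDeriv (Function.update h i (a + b)) f =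
      iterAddDeriv (Function.update h i a) f + iterAddDeriv (Function.update h i b) f := by
  induction k generalizing f with
  | zero => exact i.elim0
  | succ k ih =>
    simp only [iterAddDeriv_succ']
    refine Fin.lastCases ?_ (fun j => ?_) i
    · simp only [Fin.init_update_last, Function.update_self]
      have hadd : fwdDiff (a + b) f = fwdDiff a f + fwdDiff b f + fwdDiff a (fwdDiff b f) := by
        funext x
        simp only [fwdDiff, Pi.add_apply]
        rw [add_assoc x a b, add_comm a b]
        abel_nf
      have h0 : iterAddDeriv (Fin.init h) (fwdDiff a (fwdDiff b f)) = 0 :=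
        degLT_succ_iff.1 (degLT_succ_iff.1 hf b) a _
      rw [hadd, iterAddDeriv_add, h0, add_zero, iterAddDeriv_add]
    · have hne : ∀ c, Function.update h j.castSucc c (Fin.last k) = h (Fin.last k) := fun c =>
        Function.update_of_ne (Fin.castSucc_lt_last j).ne' _ _
      simp only [Fin.init_update_castSucc, hne]
      exact ih (degLT_succ_iff.1 hf _) _ _

variable {p : ℕ} [Module (ZMod p) V]

/-- The top-order derivative of a function of degree at most `k` as a multilinear form. -/
def topForm {k : ℕ} {f : V → ZMod p} (hf : DegLT (k + 1) f) :
    MultilinearMap (ZMod p) (fun _ : Fin k => V) (ZMod p) where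
  toFun h := iterAddDeriv h f 0
  map_update_add' {inst} h i a b := by
    obtain rfl := Subsingleton.elim inst (instDecidableEqFin k)
    exact congrFun (hf.iterAddDeriv_update_add h i a b) 0
  map_update_smul' {inst} h i c a := by
    obtain rfl := Subsingleton.elim inst (instDecidableEqFin k)
    exact ZMod.map_smul (AddMonoidHom.mk' (fun a => iterAddDeriv (Function.update h i a) f 0)
      fun a b => congrFun (hf.iterAddDeriv_update_add h i a b) 0) c a

/-- Subtracting the diagonal of the top form, divided by `k!`, lowers the degree. -/
theorem degLT_sub_topForm {k : ℕ} {f : V → ZMod p} (hf : DegLT (k + 1) f) {c : ZMod p}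
    (hc : c * (k.factorial : ZMod p) = 1) :
    DegLT k (fun x => f x - c * topForm hf (fun _ => x)) := by
  intro h
  -- The diagonal is `(fwdDiff x)^[k] f 0`, an alternating sum of dilates `f (t • x)`. The top
  -- derivative of such a dilate is `t ^ k` times that of `f`, and the alternating sum of `t ^ k` is
  -- `k!`.
  have hG : (fun x => topForm hf (fun _ => x)) = ∑ t ∈ Finset.range (k + 1),
      ((-1 : ℤ) ^ (k - t) * k.choose t) • fun x => f (t • x) := by
    funext x
    change iterAddDeriv (fun _ : Fin k => x) f 0 = _
    rw [iterAddDeriv_const, fwdDiff_iter_eq_sum_shift]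
    simp
  have hfac := congrFun (fwdDiff_iter_eq_factorial (R := ZMod p) (n := k)) 0
  rw [fwdDiff_iter_eq_sum_shift] at hfac
  have hder : iterAddDeriv h (fun x => topForm hf (fun _ => x)) =
      fun _ => (k.factorial : ZMod p) * topForm hf h := by
    rw [hG]
    change iterAddDerivHom h _ = _
    rw [map_sum]
    simp only [map_zsmul]
    funext x
    have hterm : ∀ t : ℕ, iterAddDerivHom h (fun x => f (t • x)) x
        = (t : ZMod p) ^ k * topForm hf h := by
      intro t
      change iterAddDeriv h (fun x => f (t • x)) x = _
      rw [iterAddDeriv_comp_nsmul]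
      change iterAddDeriv _ f _ = _
      rw [hf.iterAddDeriv_eq]
      change topForm hf _ = _
      have : (fun i => t • h i) = fun i => (t : ZMod p) • h i := by
        funext i; rw [Nat.cast_smul_eq_nsmul]
      rw [this, MultilinearMap.map_smul_univ]
      simp
    rw [Finset.sum_apply]
    simp only [Pi.smul_apply, hterm]
    have hfac' : (k.factorial : ZMod p) = ∑ t ∈ Finset.range (k + 1),
        ((-1 : ℤ) ^ (k - t) * k.choose t) • (t : ZMod p) ^ k := by
      simpa using hfac.symm
    rw [hfac', Finset.sum_mul]
    simp only [smul_mul_assoc]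
  have hsub : (fun x => f x - c * topForm hf (fun _ => x)) =
      f - (fun x => AddMonoidHom.mulLeft c (topForm hf (fun _ => x))) := rfl
  rw [hsub]
  change iterAddDerivHom h _ = 0
  rw [map_sub]
  change iterAddDeriv h f - iterAddDeriv h _ = 0
  rw [iterAddDeriv_comp_hom, hder]
  funext x
  rw [Pi.sub_apply, hf.iterAddDeriv_eq h x]
  change topForm hf h - c * (_ * topForm hf h) = 0
  rw [← mul_assoc, hc, one_mul, sub_self]

end Differences

/-! ### Sidorenko inequality for blow-ups -/

section Density

theorem expect_pow_le_expect_pow {α : Type} [Fintype α] [Nonempty α] {f : α → ℝ}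
    (hf : ∀ i, 0 ≤ f i) (m : ℕ) : (𝔼 i, f i) ^ m ≤ 𝔼 i, f i ^ m := by
  rcases m with _ | m
  · simp
  · have h := pow_sum_div_card_le_sum_pow (s := (Finset.univ : Finset α)) (fun i _ => hf i) m
    rw [Finset.card_univ] at h
    have hpos : (0 : ℝ) < Fintype.card α := by exact_mod_cast Fintype.card_pos
    rw [Fintype.expect_eq_sum_div_card, Fintype.expect_eq_sum_div_card, div_pow,
      pow_succ (Fintype.card α : ℝ) m, ← div_div]
    exact div_le_div_of_nonneg_right h hpos.le

/-- The Sidorenko inequality for blow-ups of a `d`-partite function. -/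
theorem expect_pow_le_expect_prod {V : Type} [Fintype V] [Nonempty V] {k : ℕ} (d : ℕ)
    (g : (Fin d → V) → ℝ) (hg : ∀ w, 0 ≤ g w) :
    (𝔼 w, g w) ^ k ^ d ≤
      𝔼 y : Fin d → Fin k → V, ∏ c : Fin d → Fin k, g fun i => y i (c i) := by
  induction d with
  | zero =>
    rw [pow_zero, pow_one, Finset.univ_unique, Finset.univ_unique, Finset.expect_singleton,
      Finset.expect_singleton, Fintype.prod_unique]
    exact (congrArg g (Subsingleton.elim _ _)).le
  | succ d ih =>
    have hsplit : (𝔼 y : Fin (d + 1) → Fin k → V, ∏ c : Fin (d + 1) → Fin k, g fun i => y i (c i))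
        = 𝔼 u : Fin k → V, 𝔼 y : Fin d → Fin k → V, ∏ c : Fin d → Fin k,
          ∏ c₀ : Fin k, g (Fin.cons (u c₀) fun i => y i (c i)) := by
      rw [← Finset.expect_product', Finset.univ_product_univ]
      refine (Fintype.expect_equiv (Fin.consEquiv fun _ => Fin k → V) _ _ fun uy => ?_).symm
      rw [Finset.prod_comm, ← Fintype.prod_prod_type']
      refine Fintype.prod_equiv (Fin.consEquiv fun _ => Fin k) _ _ fun cc => ?_
      congr 1
      funext i
      refine Fin.cases ?_ (fun j => ?_) i <;> simp [Fin.consEquiv]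
    have havg : (𝔼 w, g w) = 𝔼 w : Fin d → V, 𝔼 v : V, g (Fin.cons v w) := by
      rw [Finset.expect_comm, ← Finset.expect_product', Finset.univ_product_univ]
      exact (Fintype.expect_equiv (Fin.consEquiv fun _ => V) _ _ fun uy => rfl).symm
    have hswap : (𝔼 u : Fin k → V, 𝔼 w : Fin d → V, ∏ c₀ : Fin k, g (Fin.cons (u c₀) w))
        = 𝔼 w : Fin d → V, (𝔼 v : V, g (Fin.cons v w)) ^ k := by
      rw [Finset.expect_comm]
      refine Finset.expect_congr rfl fun w _ => ?_
      rw [Finset.expect_pow, Fintype.piFinset_univ]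
    rw [hsplit, pow_succ' k d, pow_mul]
    -- Jensen over `w`, then Jensen over `u`, then the induction hypothesis for each fixed `u`.
    calc _ ≤ (𝔼 u : Fin k → V, 𝔼 w : Fin d → V, ∏ c₀ : Fin k, g (Fin.cons (u c₀) w)) ^ k ^ d := by
          rw [hswap, havg]
          exact pow_le_pow_left₀ (pow_nonneg (Finset.expect_nonneg fun w _ =>
            Finset.expect_nonneg fun v _ => hg _) _) (expect_pow_le_expect_pow (fun w =>
            Finset.expect_nonneg fun v _ => hg _) k) _
      _ ≤ 𝔼 u : Fin k → V, (𝔼 w : Fin d → V, ∏ c₀ : Fin k, g (Fin.cons (u c₀) w)) ^ k ^ d :=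
          expect_pow_le_expect_pow (fun u => Finset.expect_nonneg fun w _ =>
            Finset.prod_nonneg fun c _ => hg _) _
      _ ≤ _ := Finset.expect_le_expect fun u _ =>
          ih (fun w => ∏ c₀ : Fin k, g (Fin.cons (u c₀) w))
            (fun w => Finset.prod_nonneg fun c _ => hg _)

open Classical in
theorem card_pow_le_card_blowup {V : Type} [Fintype V] [Nonempty V] (k d : ℕ) {δ : ℝ} (hδ : 0 ≤ δ)
    (Z : Finset (Fin d → V)) (hZ : δ * (Fintype.card V : ℝ) ^ d ≤ Z.card) :
    δ ^ k ^ d * (Fintype.card V : ℝ) ^ (d * k) ≤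
      (Finset.univ.filter fun y : Fin d → Fin k → V =>
        ∀ c : Fin d → Fin k, (fun i => y i (c i)) ∈ Z).card := by
  have h := expect_pow_le_expect_prod (k := k) d (fun w => if w ∈ Z then (1 : ℝ) else 0)
    (fun w => by split_ifs <;> norm_num)
  have hV : (0 : ℝ) < Fintype.card V := by exact_mod_cast Fintype.card_pos
  have h1 : δ ≤ 𝔼 w : Fin d → V, if w ∈ Z then (1 : ℝ) else 0 := by
    rw [Fintype.expect_eq_sum_div_card, le_div_iff₀ (by exact_mod_cast Fintype.card_pos)]
    simpa using hZ
  have h2 := (pow_le_pow_left₀ hδ h1 (k ^ d)).trans h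
  rw [Fintype.expect_eq_sum_div_card, le_div_iff₀ (by exact_mod_cast Fintype.card_pos)] at h2
  refine le_trans (le_of_eq ?_) (h2.trans (le_of_eq ?_))
  · simp [← pow_mul, mul_comm]
  · rw [Finset.card_filter, Nat.cast_sum]
    refine Finset.sum_congr rfl fun y _ => ?_
    rw [Finset.prod_ite_zero]
    simp

end Density

/-! ### The Gowers norm as the density of the radical -/

section Gowers

variable {p n d : ℕ} [Fact p.Prime]

theorem iterMulDeriv_phase {k : ℕ} (h : Fin k → Fin n → ZMod p)
    (P : (Fin n → ZMod p) → ZMod p) : iterMulDeriv h (phase P) = phase (iterAddDeriv h P) := by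
  induction k with
  | zero => rfl
  | succ k ih =>
    rw [iterAddDeriv_succ]
    have : iterMulDeriv h (phase P) = mulDeriv (h 0) (iterMulDeriv (Fin.tail h) (phase P)) := by
      simp only [iterMulDeriv, List.ofFn_succ, List.foldr_cons]
      rfl
    rw [this, ih]
    funext x
    simp only [mulDeriv, phase, fwdDiff]
    rw [sub_eq_add_neg, AddChar.map_add_eq_mul, AddChar.map_neg_eq_conj]

open Classical in
theorem le_card_radical {P : (Fin n → ZMod p) → ZMod p} (hP : DegLT (d + 1 + 1) P) {δ : ℝ}
    (hδ : 0 ≤ δ) (hnorm : δ ≤ gowersNorm (d + 1) (phase P)) :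
    δ ^ 2 ^ (d + 1) * (Fintype.card (Fin n → ZMod p) : ℝ) ^ d ≤
      (Finset.univ.filter fun w : Fin d → Fin n → ZMod p =>
        ∀ v : Fin n → ZMod p, topForm hP (Fin.snoc w v) = 0).card := by
  set N := Fintype.card (Fin n → ZMod p) with hN
  set Z := Finset.univ.filter fun w : Fin d → (Fin n → ZMod p) => ∀ v, topForm hP (Fin.snoc w v) = 0
  have hV : (0 : ℝ) < N := by
    rw [hN]; exact_mod_cast Fintype.card_pos
  -- `T (w, ·)` is additive, so its phase is a character; orthogonality leaves only the `w` for
  -- which it is trivial.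
  have hinner : ∀ w : Fin d → (Fin n → ZMod p), ∑ v : (Fin n → ZMod p), (ZMod.stdAddChar (topForm hP (Fin.snoc w v)) : ℂ)
      = if w ∈ Z then (N : ℂ) else 0 := by
    intro w
    let L : (Fin n → ZMod p) →+ ZMod p := AddMonoidHom.mk' (fun v => topForm hP (Fin.snoc w v)) fun a b => by
      have := (topForm hP).map_update_add (Fin.snoc w 0) (Fin.last d) a b
      simpa only [Fin.update_snoc_last] using this
    let ψ : AddChar (Fin n → ZMod p) ℂ := ZMod.stdAddChar.compAddMonoidHom L
    have hψ : ψ = 0 ↔ w ∈ Z := by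
      simp only [Z, Finset.mem_filter, Finset.mem_univ, true_and]
      constructor
      · intro h0 v
        have h1 : ZMod.stdAddChar (L v) = (1 : ℂ) := DFunLike.congr_fun h0 v
        rw [← AddChar.map_zero_eq_one (ZMod.stdAddChar : AddChar (ZMod p) ℂ)] at h1
        exact ZMod.injective_stdAddChar h1
      · intro h0
        ext v
        change ZMod.stdAddChar (topForm hP (Fin.snoc w v)) = (1 : ℂ)
        rw [h0 v, AddChar.map_zero_eq_one]
    have := AddChar.sum_eq_ite ψ
    simp only [hψ] at this
    exact this
  have hsum : ∑ h : Fin (d + 1) → (Fin n → ZMod p), (ZMod.stdAddChar (topForm hP h) : ℂ)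
      = (Z.card : ℂ) * N := by
    rw [← Fintype.sum_equiv (Fin.snocEquiv fun _ : Fin (d + 1) => (Fin n → ZMod p))
      (fun vw => (ZMod.stdAddChar (topForm hP (Fin.snoc vw.2 vw.1)) : ℂ)) _ fun vw => rfl,
      Fintype.sum_prod_type, Finset.sum_comm]
    simp_rw [hinner]
    rw [← Finset.sum_filter]
    simp
  have hexp : (𝔼 q : (Fin (d + 1) → (Fin n → ZMod p)) × (Fin n → ZMod p), iterMulDeriv q.1 (phase P) q.2)
      = (Z.card : ℂ) / (N : ℂ) ^ d := by
    have hVC : (N : ℂ) ≠ 0 := by exact_mod_cast hV.ne'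
    have hterm : ∀ q : (Fin (d + 1) → (Fin n → ZMod p)) × (Fin n → ZMod p), iterMulDeriv q.1 (phase P) q.2
        = ZMod.stdAddChar (topForm hP q.1) := fun q => by
      rw [iterMulDeriv_phase, phase, hP.iterAddDeriv_eq]; rfl
    simp_rw [hterm]
    rw [Fintype.expect_eq_sum_div_card, Fintype.sum_prod_type]
    simp only [Finset.sum_const, Finset.card_univ, nsmul_eq_mul, ← Finset.mul_sum, hsum]
    have hcard : Fintype.card (Fin (d + 1) → Fin n → ZMod p) = N ^ (d + 1) := by
      rw [Fintype.card_fun (α := Fin (d + 1)), Fintype.card_fin]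
    rw [Fintype.card_prod, hcard, ← hN]
    push_cast
    field_simp
    ring
  have hnorm' : gowersNorm (d + 1) (phase P) ^ 2 ^ (d + 1)
      = (Z.card : ℝ) / (N : ℝ) ^ d := by
    rw [gowersNorm, hexp, ← Real.rpow_natCast, ← Real.rpow_mul (norm_nonneg _)]
    push_cast
    rw [one_div, inv_mul_cancel₀ (by positivity), Real.rpow_one]
    simp
  rw [← le_div_iff₀ (by positivity), ← hnorm']
  exact pow_le_pow_left₀ hδ hnorm _

end Gowers

/-! ### Extending scalars to a larger finite field -/

section Extension

open MvPolynomial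

variable {p n d : ℕ} {K : Type} [Field K] [Algebra (ZMod p) K]

theorem multilinear_eq_sum (S : MultilinearMap (ZMod p) (fun _ : Fin d => Fin n → ZMod p) (ZMod p))
    (y : Fin d → Fin n → ZMod p) :
    S y = ∑ φ : Fin d → Fin n, S (fun i => Pi.single (φ i) 1) * ∏ i, y i (φ i) := by
  have hy : y = fun i => ∑ b, y i b • (Pi.single b 1 : Fin n → ZMod p) := by
    funext i
    exact pi_eq_sum_univ' (y i)
  conv_lhs => rw [hy]
  rw [MultilinearMap.map_sum]
  refine Finset.sum_congr rfl fun φ _ => ?_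
  rw [MultilinearMap.map_smul_univ, smul_eq_mul, mul_comm]

variable (K) in
/-- The polynomials `x ↦ T (x_1, …, x_d, e_j)` over an extension of the prime field. -/
noncomputable def radPoly (T : MultilinearMap (ZMod p) (fun _ : Fin (d + 1) => Fin n → ZMod p) (ZMod p))
    (j : Fin n) : MvPolynomial (Fin d × Fin n) K :=
  ∑ φ : Fin d → Fin n,
    C (algebraMap (ZMod p) K (T (Fin.snoc (fun i => Pi.single (φ i) 1) (Pi.single j 1)))) *
      ∏ i, X (i, φ i)

variable (T : MultilinearMap (ZMod p) (fun _ : Fin (d + 1) => Fin n → ZMod p) (ZMod p))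

theorem algebraMap_snoc_single (y : Fin d → Fin n → ZMod p) (j : Fin n) :
    algebraMap (ZMod p) K (T (Fin.snoc y (Pi.single j 1))) = ∑ φ : Fin d → Fin n,
      algebraMap (ZMod p) K (T (Fin.snoc (fun i => Pi.single (φ i) 1) (Pi.single j 1))) *
        ∏ i, algebraMap (ZMod p) K (y i (φ i)) := by
  have h := multilinear_eq_sum ((LinearMap.applyₗ (Pi.single j 1 : Fin n → ZMod p)).compMultilinearMap
    T.curryRight) y
  have h' : T (Fin.snoc y (Pi.single j 1)) = ∑ φ : Fin d → Fin n,
      T (Fin.snoc (fun i => Pi.single (φ i) 1) (Pi.single j 1)) * ∏ i, y i (φ i) := h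
  rw [h', map_sum]
  simp only [map_mul, map_prod]

theorem eval_diagonal_radPoly (z : Fin n → ZMod p) (j : Fin n) :
    eval (fun ib => algebraMap (ZMod p) K (z ib.2)) (radPoly K T j)
      = algebraMap (ZMod p) K (T (Fin.snoc (fun _ => z) (Pi.single j 1))) := by
  rw [algebraMap_snoc_single, radPoly, map_sum]
  simp only [map_mul, eval_C, map_prod, eval_X]

/-- Writing a point of `K ^ n` in the basis `e` and expanding multilinearly expresses the value
through `T` at the mixed tuples `(y i (c i))`. If all of these lie in the radical, the point is a
zero. -/
theorem eval_radPoly {k : ℕ} (e : Module.Basis (Fin k) (ZMod p) K)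
    (y : Fin d → Fin k → Fin n → ZMod p) (j : Fin n) :
    eval (fun ib => e.equivFun.symm fun c => y ib.1 c ib.2) (radPoly K T j)
      = ∑ c : Fin d → Fin k, (∏ i, e (c i)) *
        algebraMap (ZMod p) K (T (Fin.snoc (fun i => y i (c i)) (Pi.single j 1))) := by
  have h : ∀ c : Fin d → Fin k, _ := fun c =>
    algebraMap_snoc_single (K := K) T (fun i => y i (c i)) j
  simp_rw [h, radPoly, map_sum, Finset.mul_sum]
  rw [Finset.sum_comm]
  refine Finset.sum_congr rfl fun φ _ => ?_
  simp only [map_mul, eval_C, map_prod, eval_X, Module.Basis.equivFun_symm_apply, Algebra.smul_def]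
  rw [Finset.prod_univ_sum, Fintype.piFinset_univ, Finset.mul_sum]
  refine Finset.sum_congr rfl fun c _ => ?_
  rw [Finset.prod_mul_distrib]
  ring

theorem totalDegree_radPoly_le (j : Fin n) : (radPoly K T j).totalDegree ≤ d := by
  refine totalDegree_finsetSum_le fun φ _ => ?_
  rw [← MvPolynomial.smul_eq_C_mul]
  refine (totalDegree_smul_le _ _).trans ((totalDegree_finsetProd _ _).trans ?_)
  simp

/-- Translating a product of `d` variables changes only its lower-degree terms, so the base point
supplied by the main induction is immaterial. -/
theorem homogeneousComponent_shift_radPoly (x : Fin d × Fin n → K) (j : Fin n) :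
    homogeneousComponent d (shift x (radPoly K T j)) = radPoly K T j := by
  rw [radPoly, map_sum, map_sum]
  refine Finset.sum_congr rfl fun φ _ => ?_
  rw [← MvPolynomial.smul_eq_C_mul, map_smul, map_smul, map_prod, ← scaleHom_coeff, map_prod]
  congr 1
  have hX : ∀ i : Fin d, scaleHom (shift x (X (i, φ i))) = Polynomial.C (X (i, φ i)) * Polynomial.X
      + Polynomial.C (C (x (i, φ i))) := fun i => by simp [shift, scaleHom]
  have h := Polynomial.coeff_prod_of_natDegree_le (s := (Finset.univ : Finset (Fin d)))
    (fun i => scaleHom (shift x (X (i, φ i)))) 1 fun i _ => by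
      rw [hX]; exact Polynomial.natDegree_linear_le
  rw [Finset.card_univ, Fintype.card_fin, mul_one] at h
  rw [h]
  refine Finset.prod_congr rfl fun i _ => ?_
  rw [hX, Polynomial.coeff_add, Polynomial.coeff_C_mul, Polynomial.coeff_X_one, mul_one,
    Polynomial.coeff_C_of_ne_zero one_ne_zero, add_zero]

open Classical in
theorem card_blowup_le_card_zeros [Fact p.Prime] [Fintype K] {k : ℕ}
    (e : Module.Basis (Fin k) (ZMod p) K) {Z : Finset (Fin d → Fin n → ZMod p)}
    (hZ : ∀ w ∈ Z, ∀ v : Fin n → ZMod p, T (Fin.snoc w v) = 0) :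
    (Finset.univ.filter fun y : Fin d → Fin k → Fin n → ZMod p => ∀ c : Fin d → Fin k,
      (fun i => y i (c i)) ∈ Z).card ≤
    (Finset.univ.filter fun x : Fin d × Fin n → K => ∀ j, eval x (radPoly K T j) = 0).card := by
  refine Finset.card_le_card_of_injOn
    (fun y ib => e.equivFun.symm fun c => y ib.1 c ib.2) (fun y hy => ?_) ?_
  · simp only [Finset.coe_filter, Finset.mem_univ, true_and, Set.mem_ofPred_eq] at hy ⊢
    intro j
    rw [eval_radPoly]
    simp [fun c => hZ _ (hy c)]
  · intro y _ y' _ h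
    funext i c b
    exact congrFun (e.equivFun.symm.injective (congrFun h (i, b))) c

theorem algebraMap_diagonal_eq_sum (z : Fin n → ZMod p) :
    algebraMap (ZMod p) K (T fun _ => z) = ∑ j, algebraMap (ZMod p) K (z j) *
      eval (fun ib => algebraMap (ZMod p) K (z ib.2)) (radPoly K T j) := by
  simp_rw [eval_diagonal_radPoly, ← map_mul]
  rw [← map_sum]
  congr 1
  have hz : (fun _ => z : Fin (d + 1) → Fin n → ZMod p)
      = Fin.snoc (fun _ : Fin d => z) (∑ j, z j • (Pi.single j 1 : Fin n → ZMod p)) := by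
    rw [← pi_eq_sum_univ' z]
    funext i
    refine Fin.lastCases ?_ (fun i => ?_) i <;> simp
  rw [hz]
  change T.curryRight (fun _ => z) _ = ∑ j, z j * T.curryRight (fun _ => z) (Pi.single j 1)
  simp [map_sum]

end Extension

/-! ### From the decomposition to the rank bound -/

section Final

open MvPolynomial

variable {p n d : ℕ}

theorem isFunctionOf_card {ι : Type} [Fintype ι] {P : (Fin n → ZMod p) → ZMod p}
    (Q : ι → (Fin n → ZMod p) → ZMod p) (hQ : ∀ i, DegLT (d + 1) (Q i))
    (B : (ι → ZMod p) → ZMod p) (hP : ∀ x, P x = B fun i => Q i x) :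
    IsFunctionOf d (Fintype.card ι) P := by
  refine ⟨fun i => Q ((Fintype.equivFin ι).symm i), fun q => B fun i => q (Fintype.equivFin ι i),
    fun i => hQ _, fun x => ?_⟩
  simp [hP]

theorem isFunctionOf_of_hasDecomp [Fact p.Prime] {K : Type} [Field K] [Algebra (ZMod p) K] {k R : ℕ}
    (e : Module.Basis (Fin k) (ZMod p) K) {P : (Fin n → ZMod p) → ZMod p}
    (hP : DegLT (d + 1 + 1) P) (hfac : ((d + 1).factorial : ZMod p) ≠ 0)
    (hdec : HasDecomp d R (radPoly K (topForm hP))) :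
    IsFunctionOf d (2 * (R * k) + 1) P := by
  obtain ⟨A, B, hA, hB, hAB⟩ := hdec
  set T := topForm hP
  let diag : (Fin d × Fin n) → (Fin n → ZMod p) → K := fun ib z => algebraMap (ZMod p) K (z ib.2)
  have hlin : ∀ j : Fin n, DegLT 2 fun z : Fin n → ZMod p => algebraMap (ZMod p) K (z j) := fun j =>
    degLT_hom ((algebraMap (ZMod p) K).toAddMonoidHom.comp (Pi.evalAddMonoidHom (fun _ : Fin n => ZMod p) j))
  let α : Fin R → (Fin n → ZMod p) → K := fun i z => eval (fun ib => diag ib z) (A i)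
  -- The extra factor `z j` raises the degree by one, which is affordable since `B i j` has degree
  -- less than `d`.
  let β : Fin R → (Fin n → ZMod p) → K := fun i =>
    ∑ j, (fun z => algebraMap (ZMod p) K (z j)) * fun z => eval (fun ib => diag ib z) (B i j)
  have hα : ∀ i, DegLT (d + 1) (α i) := fun i =>
    (degLT_eval (A i) (y := diag) fun ib => hlin ib.2).mono (Nat.succ_le_succ (hA i))
  have hβ : ∀ i, DegLT (d + 1) (β i) := fun i => degLT_sum _ fun j _ =>
    (hlin j).mul (degLT_eval (B i j) (y := diag) fun ib => hlin ib.2)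
      (by have := hB i j; omega)
  have hT : ∀ z, algebraMap (ZMod p) K (T fun _ => z) = ∑ i, α i z * β i z := by
    intro z
    rw [algebraMap_diagonal_eq_sum]
    simp_rw [hAB, map_sum, map_mul, Finset.mul_sum]
    rw [Finset.sum_comm]
    refine Finset.sum_congr rfl fun i _ => ?_
    simp only [β, α, diag, Finset.sum_apply, Pi.mul_apply, Finset.mul_sum]
    exact Finset.sum_congr rfl fun j _ => by ring
  set c : ZMod p := ((d + 1).factorial : ZMod p)⁻¹
  have hlow := degLT_sub_topForm hP (inv_mul_cancel₀ hfac)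
  have hcoord : ∀ (γ : (Fin n → ZMod p) → K), DegLT (d + 1) γ → ∀ l,
      DegLT (d + 1) (fun z => e.equivFun (γ z) l) := fun γ hγ l =>
    hγ.comp_hom (e.coord l).toAddMonoidHom
  have hcard : Fintype.card (((Fin R × Fin k) ⊕ (Fin R × Fin k)) ⊕ Unit) = 2 * (R * k) + 1 := by
    simp; ring
  rw [← hcard]
  refine isFunctionOf_card
    (Sum.elim (Sum.elim (fun il z => e.equivFun (α il.1 z) il.2)
      (fun il z => e.equivFun (β il.1 z) il.2)) (fun _ z => P z - c * T fun _ => z)) ?_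
    -- On arbitrary inputs the sum of products need not lie in the prime field, so a left inverse of
    -- the embedding with junk values elsewhere is used; at the actual values it returns `T (z, …,
    -- z)`.
    (fun q => c * Function.invFun (algebraMap (ZMod p) K)
      (∑ i, e.equivFun.symm (fun l => q (Sum.inl (Sum.inl (i, l)))) *
        e.equivFun.symm (fun l => q (Sum.inl (Sum.inr (i, l))))) + q (Sum.inr ())) ?_
  · rintro ((⟨i, l⟩ | ⟨i, l⟩) | _)
    · exact hcoord _ (hα i) l
    · exact hcoord _ (hβ i) l
    · exact hlow
  · intro z
    have hsymm : ∀ w : K, e.equivFun.symm (fun l => e.equivFun w l) = w :=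
      e.equivFun.symm_apply_apply
    simp only [Sum.elim_inl, Sum.elim_inr, hsymm, ← hT]
    rw [Function.leftInverse_invFun (algebraMap (ZMod p) K).injective]
    ring

/-- Exponential beats polynomial growth. This fixes the extension degree independently of `p`, as `p
^ k ≥ 2 ^ k`. -/
theorem exists_pow_le_two_pow (a d m : ℕ) : ∃ k : ℕ, k ≠ 0 ∧ (a * k ^ d + d + 3) ^ m ≤ 2 ^ k := by
  have h := tendsto_pow_const_div_const_pow_of_one_lt (d * m) (by norm_num : (1 : ℝ) < 2)
  have hpos : (0 : ℝ) < 1 / (a + d + 3) ^ m := by positivity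
  obtain ⟨k, hk, hk0⟩ := ((h.eventually (gt_mem_nhds hpos)).and
    (Filter.eventually_ge_atTop 1)).exists
  refine ⟨k, by omega, ?_⟩
  rw [div_lt_div_iff₀ (by positivity) (by positivity), one_mul] at hk
  have h1 : a * k ^ d + d + 3 ≤ (a + d + 3) * k ^ d := by
    have : 1 ≤ k ^ d := Nat.one_le_pow _ _ hk0
    nlinarith
  calc (a * k ^ d + d + 3) ^ m ≤ ((a + d + 3) * k ^ d) ^ m := Nat.pow_le_pow_left h1 m
    _ = k ^ (d * m) * (a + d + 3) ^ m := by rw [mul_pow, ← pow_mul, mul_comm]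
    _ ≤ 2 ^ k := by exact_mod_cast hk.le

open Classical in
theorem card_pow_le_card_zeros_radPoly [Fact p.Prime] {K : Type} [Field K] [Fintype K]
    [Algebra (ZMod p) K] {k a b : ℕ} (hk : k ≠ 0) (hK : Fintype.card K = p ^ k)
    (e : Module.Basis (Fin k) (ZMod p) K) (hb : a * k ^ d ≤ b) {δ : ℝ} (hδ : 0 ≤ δ)
    (ha : (1 / 2 : ℝ) ^ a ≤ δ ^ 2 ^ (d + 1)) {P : (Fin n → ZMod p) → ZMod p}
    (hP : DegLT (d + 1 + 1) P) (hnorm : δ ≤ gowersNorm (d + 1) (phase P)) :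
    Fintype.card K ^ Fintype.card (Fin d × Fin n) ≤
      (Finset.univ.filter fun x : Fin d × Fin n → K =>
        ∀ j, eval x (radPoly K (topForm hP) j) = 0).card * Fintype.card K ^ b := by
  obtain ⟨Z, hZ0, hZ⟩ : ∃ Z : Finset (Fin d → Fin n → ZMod p),
      (∀ w ∈ Z, ∀ v, topForm hP (Fin.snoc w v) = 0) ∧
        (1 / 2 : ℝ) ^ a * (Fintype.card (Fin n → ZMod p) : ℝ) ^ d ≤ Z.card :=
    ⟨_, fun w hw => (Finset.mem_filter.1 hw).2,
      (mul_le_mul_of_nonneg_right ha (pow_nonneg (Nat.cast_nonneg _) d)).trans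
        (le_card_radical hP hδ hnorm)⟩
  have hA := card_pow_le_card_blowup k d (pow_nonneg (by norm_num) a) Z hZ
  replace hA := hA.trans (Nat.cast_le.2 ((le_of_eq (by congr)).trans
    (card_blowup_le_card_zeros (topForm hP) e hZ0)))
  set A := (Finset.univ.filter fun x : Fin d × Fin n → K =>
    ∀ j, eval x (radPoly K (topForm hP) j) = 0).card
  have hp2 : (2 : ℝ) ≤ (p : ℝ) ^ k := by
    exact_mod_cast (Fact.out : p.Prime).two_le.trans (Nat.le_self_pow hk p)
  have h2 : (2 : ℝ) ^ (a * k ^ d) ≤ ((p : ℝ) ^ k) ^ b :=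
    (pow_le_pow_right₀ (by norm_num) hb).trans (pow_le_pow_left₀ (by norm_num) hp2 b)
  have h3 : ((1 / 2 : ℝ) ^ a) ^ k ^ d * 2 ^ (a * k ^ d) = 1 := by
    rw [← pow_mul, ← mul_pow]; norm_num
  have hV : (Fintype.card (Fin n → ZMod p) : ℝ) ^ (d * k)
      = ((p : ℝ) ^ k) ^ Fintype.card (Fin d × Fin n) := by
    simp only [Fintype.card_fun, Fintype.card_prod, Fintype.card_fin, ZMod.card]
    push_cast
    rw [← pow_mul, ← pow_mul]
    congr 1
    ring
  rw [hV] at hA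
  rw [hK, ← Nat.cast_le (α := ℝ)]
  push_cast
  calc ((p : ℝ) ^ k) ^ Fintype.card (Fin d × Fin n)
      = ((1 / 2 : ℝ) ^ a) ^ k ^ d * 2 ^ (a * k ^ d)
          * ((p : ℝ) ^ k) ^ Fintype.card (Fin d × Fin n) := by rw [h3, one_mul]
    _ = ((1 / 2 : ℝ) ^ a) ^ k ^ d * ((p : ℝ) ^ k) ^ Fintype.card (Fin d × Fin n)
          * 2 ^ (a * k ^ d) := by ring
    _ ≤ A * ((p : ℝ) ^ k) ^ b := mul_le_mul hA h2 (by positivity) (by positivity)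

end Final

end PolyGowers

open PolyGowers in
theorem mainTheorem12 (d : ℕ) (hd : 2 ≤ d + 1) (δ : ℝ) (hδ : 0 < δ) :
    ∃ K : ℕ, ∀ (p : ℕ) [Fact p.Prime], d + 1 < p →
      ∀ (n : ℕ) (P : (Fin n → ZMod p) → ZMod p),
        P ∈ PolyGowers.polys p n (d + 1) →
        δ ≤ PolyGowers.gowersNorm (d + 1) (PolyGowers.phase P) →
        PolyGowers.rank d P ≤ (K : ℕ∞) := by
  classical
  obtain ⟨a, ha⟩ := exists_pow_lt_of_lt_one (pow_pos hδ (2 ^ (d + 1)))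
    (by norm_num : (1 / 2 : ℝ) < 1)
  obtain ⟨k, hk0, hk⟩ := exists_pow_le_two_pow a d (8 * 3 ^ d)
  -- The exponent `a k ^ d` measures the density over the extension; `d` covers the degree of
  -- `radPoly`, and `3` meets the requirement `3 ≤ b`.
  obtain ⟨R, hR⟩ := exists_hasDecomp d (a * k ^ d + d + 3) (by omega)
  refine ⟨2 * (R * k) + 1, fun p _ hp n P hP hnorm => ?_⟩
  have hP' : DegLT (d + 1 + 1) P := hP
  have hfac : ∀ m, m < p → (m.factorial : ZMod p) ≠ 0 := fun m hm => by
    rw [Ne, ZMod.natCast_eq_zero_iff, (Fact.out : p.Prime).dvd_factorial]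
    omega
  have _ : Fintype (GaloisField p k) := Fintype.ofFinite _
  have hcard : Fintype.card (GaloisField p k) = p ^ k := by
    rw [← Nat.card_eq_fintype_card]; exact GaloisField.card p k hk0
  have e : Module.Basis (Fin k) (ZMod p) (GaloisField p k) :=
    Module.finBasisOfFinrankEq (ZMod p) _ (GaloisField.finrank p hk0)
  have hdfac : (d.factorial : GaloisField p k) ≠ 0 := by
    rw [← map_natCast (algebraMap (ZMod p) (GaloisField p k))]
    exact (map_ne_zero _).2 (hfac d (by omega))
  obtain ⟨x, _, hx⟩ := hR (GaloisField p k) (Fin d × Fin n) (Fin n) hdfac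
    (hk.trans ((Nat.pow_le_pow_left (Fact.out : p.Prime).two_le k).trans_eq hcard.symm))
    (radPoly (GaloisField p k) (topForm hP'))
    (fun j => (totalDegree_radPoly_le _ j).trans (by omega)) _
    (fun x hx => (Finset.mem_filter.1 hx).2)
    (card_pow_le_card_zeros_radPoly hk0 hcard e (by omega) hδ.le ha.le hP' hnorm)
  simp only [homogeneousComponent_shift_radPoly] at hx
  exact iInf₂_le (f := fun (k : ℕ) (_ : IsFunctionOf d k P) => (k : ℕ∞)) _
    (isFunctionOf_of_hasDecomp e hP' (hfac _ hp) hx)
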